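/- Let $\mathbb F$ be an algebraically closed field of characteristic $p>3$, let $n\ge 1$, let $\underline t=(t_1,\dots,t_n)$ be a tuple of positive integers, and put $\pi_i=p^{t_i}-1$, $|\pi|=\pi_1+\dots+\pi_n$ and $\xi=|\pi|+n$. Let $\mathcal O(n,m;\underline t)$ be the tensor product of the truncated divided power algebra with basis $x^{(\alpha)}$ ($0\le\alpha_i\le\pi_i$, $x^{(\alpha)}x^{(\beta)}=\prod_i\binom{\alpha_i+\beta_i}{\alpha_i}x^{(\alpha+\beta)}$, and $x^{(\gamma)}=0$ for $\gamma$ out of range) and the exterior algebra in the odd variables $x_{n+1},\dots,x_{n+m}$; it is a supercommutative superalgebra. Write $x_i=x^{(\varepsilon_i)}$ for $i\le n$, and let $\partial_r$ be the superderivations with $\partial_i x^{(\alpha)}=x^{(\alpha-\varepsilon_i)}$, $\partial_i x_s=0$ for $i\le n<s$, and $\partial_r x^{(\alpha)}=0$, $\partial_r x_s=\delta_{rs}$ for $r,s>n$. Let $W(n,m;\underline t)$ be the Lie superalgebra, under the supercommutator, of all operators $\sum_r f_r\partial_r$ with $f_r\in\mathcal O(n,m;\underline t)$. Let $\mathrm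 p$ denote parity, put $i'=i+n$ for $i\le n$ and $i'=i-n$ for $n<i\le 2n$, let $\mathfrak D=\sum_{i=1}^{2n}x_i\partial_i$, and for homogeneous $a$ put $$\mathrm T_H(a)=\sum_{i=1}^{2n}(-1)^{\mathrm p(\partial_i)\mathrm p(a)}\partial_i(a)\,\partial_{i'},$$ $$\mathrm T_K(a)=\mathrm T_H(a)+(-1)^{\mathrm p(a)}\partial_{2n+1}(a)\,\mathfrak D+(\mathfrak D(a)-2a)\,\partial_{2n+1},$$ extended linearly to all $a$. Let $$HO=\{\mathrm T_H(a): a\in\mathcal O(n,n;\underline t)\}\subset W(n,n;\underline t),\qquad KO=\{\mathrm T_K(a): a\in\mathcal O(n,n+1;\underline t)\}\subset W(n,n+1;\underline t).$$ Grade $HO$ by the grading of $W(n,n;\underline t)$ in which every variable has degree $1$, and $KO$ by the grading of $W(n,n+1;\underline t)$ in which $x_{2n+1}$ has degree $2$ and every other variable has degree $1$ (in both cases $\partial_r$ has minus the degree of $x_r$). Let $KO_\theta$ be the zero weight space of $KO$ with respect to the torus spanned by the elements $\mathrm T_K(x_ix_{i'})$, $1\le i\le n$. Theorem. $HO$ and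 $KO$ are closed under the supercommutator, and neither of these Lie superalgebras $X$ has a nondegenerate associative form, i.e. a nondegenerate bilinear form $\beta:X\times X\to\mathbb F$ with $\beta([x,y],z)=\beta(x,[y,z])$ for all $x,y,z\in X$. Moreover, $$\dim HO_{\xi-2}=1,\quad \dim HO_{-1}=2n,\quad \dim (KO_{\xi}\cap KO_\theta)=0,\quad \dim (KO_{-2}\cap KO_\theta)=1.$$ -/

import Mathlib

namespace OddCartan

/-- Indices `(α, u)` of the standard basis `x^(α) x^u` of `𝒪(n, m; t)`: an exponent `α` with
`0 ≤ α i ≤ p ^ t i - 1` for the `n` even variables, and a set `u` of odd variables. -/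
abbrev Mono (p n m : ℕ) (t : Fin n → ℕ) : Type :=
  ((i : Fin n) → Fin (p ^ t i)) × Finset (Fin m)

/-- The underlying space of the superalgebra `𝒪(n, m; t)`, the tensor product of the truncated
divided power algebra in `n` variables and the exterior algebra in `m` variables: the vector space
with basis indexed by `Mono p n m t`. -/
def O (F : Type*) [Field F] (p n m : ℕ) (t : Fin n → ℕ) : Type _ :=
  Mono p n m t →₀ F

section

variable {F : Type*} [Field F] {p n m : ℕ} {t : Fin n → ℕ}

noncomputable instance : AddCommGroup (O F p n m t) :=
  inferInstanceAs (AddCommGroup (Mono p n m t →₀ F))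

noncomputable instance : Module F (O F p n m t) :=
  inferInstanceAs (Module F (Mono p n m t →₀ F))

/-- The standard basis of `𝒪(n, m; t)`; the basis vector with index `(α, u)` is `x^(α) x^u`. -/
noncomputable def bas : Module.Basis (Mono p n m t) F (O F p n m t) :=
  Module.Basis.ofRepr (LinearEquiv.refl F (Mono p n m t →₀ F))

/-- The exponent of a basis monomial as a tuple of natural numbers. -/
def expo (a : Mono p n m t) : Fin n → ℕ := fun i => (a.1 i : ℕ)

/-- The element `x^(α) x^u`, with the convention that `x^(α) = 0` if `α` is out of range. The odd
variables in `x^u` are multiplied in increasing order. -/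
noncomputable def mon (α : Fin n → ℕ) (u : Finset (Fin m)) : O F p n m t := by
  classical
  exact if h : ∀ i, α i < p ^ t i then bas (fun i => ⟨α i, h i⟩, u) else 0

/-- The number of inversions needed to sort `x^u x^v`. -/
def inversions (u v : Finset (Fin m)) : ℕ :=
  ((u ×ˢ v).filter fun q => q.2 < q.1).card

/-- The product of `𝒪(n, m; t)`:
`x^(α) x^u * x^(β) x^v = ± (α + β choose α) x^(α + β) x^(u ∪ v)` for disjoint `u`, `v`, and `0`
otherwise. Thus `mul f` is left multiplication by `f`. -/
noncomputable def mul : O F p n m t →ₗ[F] Module.End F (O F p n m t) :=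
  bas.constr F fun a =>
    bas.constr F fun b =>
      if Disjoint a.2 b.2 then
        ((-1 : F) ^ inversions a.2 b.2 *
          ((∏ i, (expo a i + expo b i).choose (expo a i) : ℕ) : F)) •
            mon (expo a + expo b) (a.2 ∪ b.2)
      else 0

/-- The even superderivation `∂_i` for an even variable:
`∂_i (x^(α) x^u) = x^(α - ε_i) x^u`. -/
noncomputable def dEven (i : Fin n) : Module.End F (O F p n m t) :=
  bas.constr F fun a =>
    if expo a i = 0 then 0 else mon (expo a - Pi.single i 1) a.2

/-- The odd superderivation `∂_j` for an odd variable: it sends `x^(α)` to `0` and the odd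
variable `x_k` to `δ_{jk}`. -/
noncomputable def dOdd (j : Fin m) : Module.End F (O F p n m t) :=
  bas.constr F fun a =>
    if j ∈ a.2 then (-1 : F) ^ (a.2.filter (· < j)).card • mon (expo a) (a.2.erase j) else 0

/-- The even variable `x_i`. -/
noncomputable def xEven (i : Fin n) : O F p n m t := mon (Pi.single i 1) ∅

/-- The odd variable `x_j`. -/
noncomputable def xOdd (j : Fin m) : O F p n m t := mon 0 {j}

/-- The projection of `𝒪(n, m; t)` onto its even part. -/
noncomputable def projEven : Module.End F (O F p n m t) :=
  bas.constr F fun a =>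
    if Even a.2.card then bas a else 0

/-- The projection of `𝒪(n, m; t)` onto its odd part. -/
noncomputable def projOdd : Module.End F (O F p n m t) := 1 - projEven

/-- The odd part of an endomorphism of the superspace `𝒪(n, m; t)`. -/
noncomputable def oddPart (A : Module.End F (O F p n m t)) : Module.End F (O F p n m t) :=
  projEven * A * projOdd + projOdd * A * projEven

/-- The supercommutator, i.e. the bilinear operation with `[A, B] = A B - (-1)^(p(A) p(B)) B A`
for homogeneous `A`, `B`: it is `A B + B A` if both are odd, and `A B - B A` if one is even. -/
noncomputable def sbr (A B : Module.End F (O F p n m t)) : Module.End F (O F p n m t) :=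
  A * B - B * A + (2 : F) • (oddPart B * oddPart A)

/-- The degree of a basis monomial if even variables have degree `1` and the odd variable `x_j`
has degree `w j`. -/
def deg (w : Fin m → ℕ) (a : Mono p n m t) : ℕ := ∑ i, expo a i + ∑ j ∈ a.2, w j

variable (F p t) in
/-- The component of degree `k` of the generalized Witt superalgebra `W(n, m; t)`, with respect to
the grading of type `(1, …, 1 | w)`: it is spanned by all `f ∂` where `f` is a monomial of degree
`k` plus the degree of the variable belonging to `∂`. -/
noncomputable def wittGr (w : Fin m → ℕ) (k : ℤ) : Submodule F (Module.End F (O F p n m t)) :=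
  Submodule.span F
    ({A | ∃ (a : Mono p n m t) (i : Fin n), (deg w a : ℤ) = k + 1 ∧
        A = mul (bas a) * dEven i} ∪
     {A | ∃ (a : Mono p n m t) (j : Fin m), (deg w a : ℤ) = k + w j ∧
        A = mul (bas a) * dOdd j})

/-- The operator `T_H`, where `e` is the bijection `i ↦ i'` of the even variables onto the first
`n` odd variables:
`T_H(a) = ∑ i ∈ {1, …, 2n}, (-1)^(p(∂_i) p(a)) ∂_i(a) ∂_{i'}` for homogeneous `a`. -/
noncomputable def TH (e : Fin n → Fin m) : O F p n m t →ₗ[F] Module.End F (O F p n m t) :=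
  bas.constr F fun a =>
    ∑ i, (mul (dEven i (bas a)) * dOdd (e i) +
      (-1 : F) ^ a.2.card • (mul (dOdd (e i) (bas a)) * dEven i))

/-- The operator `𝔇 = ∑ i ∈ {1, …, 2n}, x_i ∂_i` on `𝒪(n, n + 1; t)`. -/
noncomputable def euler : Module.End F (O F p n (n + 1) t) :=
  ∑ i : Fin n, (mul (xEven i) * dEven i + mul (xOdd i.castSucc) * dOdd i.castSucc)

/-- The operator `T_K` on `𝒪(n, n + 1; t)`: for homogeneous `a`,
`T_K(a) = T_H(a) + (-1)^(p(a)) ∂_{2n+1}(a) 𝔇 + (𝔇(a) - 2 a) ∂_{2n+1}`. -/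
noncomputable def TK : O F p n (n + 1) t →ₗ[F] Module.End F (O F p n (n + 1) t) :=
  bas.constr F fun a =>
    TH Fin.castSucc (bas a) +
      (-1 : F) ^ a.2.card • (mul (dOdd (Fin.last n) (bas a)) * euler) +
      mul (euler (bas a) - (2 : F) • bas a) * dOdd (Fin.last n)

variable (F p n t) in
/-- The odd Hamiltonian superalgebra `HO(n, n; t)`, as a subspace of `W(n, n; t)`. -/
noncomputable def HO : Submodule F (Module.End F (O F p n n t)) := LinearMap.range (TH id)

variable (F p n t) in
/-- The odd contact superalgebra `KO(n, n + 1; t)`, as a subspace of `W(n, n + 1; t)`. -/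
noncomputable def KO : Submodule F (Module.End F (O F p n (n + 1) t)) := LinearMap.range TK

variable (F p n t) in
/-- The component of degree `k` of `HO` in the standard grading. -/
noncomputable def HOgr (k : ℤ) : Submodule F (Module.End F (O F p n n t)) :=
  HO F p n t ⊓ wittGr F p t (fun _ => 1) k

variable (F p n t) in
/-- The component of degree `k` of `KO` in the principal grading, in which the last odd variable
has degree `2`. -/
noncomputable def KOgr (k : ℤ) : Submodule F (Module.End F (O F p n (n + 1) t)) :=
  KO F p n t ⊓ wittGr F p t (fun j => if j = Fin.last n then 2 else 1) k

variable (F p n t) in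
/-- The standard torus of `KO`, spanned by the `T_K(x_i x_{i'})` for `1 ≤ i ≤ n`. -/
noncomputable def torusKO : Submodule F (Module.End F (O F p n (n + 1) t)) :=
  Submodule.span F (Set.range fun i : Fin n => TK (mul (xEven i) (xOdd i.castSucc)))

/-- The weight space of weight `γ` for the adjoint action of `H` on `L`: all `A ∈ L` with
`[h, A] = γ(h) A` for every `h ∈ H`. -/
noncomputable def weightSpace (L H : Submodule F (Module.End F (O F p n m t))) (γ : H → F) :
    Submodule F (Module.End F (O F p n m t)) where
  carrier := {A | A ∈ L ∧ ∀ h : H, sbr (h : Module.End F (O F p n m t)) A = γ h • A}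
  zero_mem' := ⟨L.zero_mem, fun h => by
    simp only [sbr, oddPart, mul_zero, zero_mul, add_zero, smul_zero]
    exact sub_zero _⟩
  add_mem' := by
    rintro A B ⟨hA, hA'⟩ ⟨hB, hB'⟩
    refine ⟨L.add_mem hA hB, fun h => ?_⟩
    rw [smul_add, ← hA' h, ← hB' h]
    simp only [sbr, oddPart, mul_add, add_mul, smul_add]
    abel
  smul_mem' := by
    rintro c A ⟨hA, hA'⟩
    refine ⟨L.smul_mem c hA, fun h => ?_⟩
    rw [smul_comm, ← hA' h]
    simp only [sbr, oddPart, mul_smul_comm, smul_mul_assoc, add_mul, smul_add, smul_sub,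
      smul_comm c (2 : F)]

/-- `|π| + n`, the largest degree of a monomial in `𝒪(n, n; t)`, where `π i = p ^ t i - 1`. -/
def xi (p n : ℕ) (t : Fin n → ℕ) : ℕ := ∑ i, (p ^ t i - 1) + n

/-- A subspace of endomorphisms that is closed under the supercommutator. -/
def IsClosedSbr (L : Submodule F (Module.End F (O F p n m t))) : Prop :=
  ∀ A ∈ L, ∀ B ∈ L, sbr A B ∈ L

/-- A bilinear form `β` on a Lie superalgebra `L` is associative (invariant) if
`β([x, y], z) = β(x, [y, z])` for all `x, y, z` in `L`. -/
def IsAssociative {L : Submodule F (Module.End F (O F p n m t))} (hL : IsClosedSbr L)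
    (β : LinearMap.BilinForm F L) : Prop :=
  ∀ x y z : L, β ⟨sbr x y, hL x x.2 y y.2⟩ z = β x ⟨sbr y z, hL y y.2 z z.2⟩

end

end OddCartan

namespace OddCartan

/-! ### Monomials and the supercommutative divided power algebra. -/

section Algebra

variable {F : Type*} [Field F] {p n m : ℕ} {t : Fin n → ℕ}

/-! Both algebras are images of a linear map T (`TH` or `TK`) of one shape. Take even derivations
X_i, odd derivations Y_i and an odd derivation Z, all supercommuting except that [Y_i, X_i] = -2Z.
For f of parity sign s put T(f) = Σ (X_i(f) Y_i + s Y_i(f) X_i) - 2 f Z. For HO these are ∂_i,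
∂_{i'} and Z = 0; for KO they are ∂_i - x_{i'} ∂_{2n+1}, ∂_{i'} + x_i ∂_{2n+1} and ∂_{2n+1}. A
formal computation from the relations (`IsContactFrame.bracket`) gives [T(a), T(b)] = T(c(a, b))
with c(a, b) = T(a)(b) - 2 (-1)^{p(a)} Z(a) b. This proves closure.

An associative form pulls back along T to a form B with B(c(a, b), w) = B(a, c(b, w)), and it
suffices to find u with T(u) ≠ 0 and B(u, ·) = 0 for every such B (`not_exists_isAssociative`). For
HO take u = x_i, for KO take u = 1. Associativity with x_i or x_{i'} in the middle slot, and also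
with 1 for KO, kills B(u, ·) on the images of ∂_i and ∂_{i'}. A monomial a in neither image has
exponent π_i in x_i and contains x_{i'} (`bas_cases`). Since π_i = -1 in the field, T(x_i x_{i'}) =
x_{i'} ∂_{i'} - x_i ∂_i multiplies a by 1 - (-1) = 2. With x_i x_{i'} in the middle slot,
associativity then reads B(u, a) = 2 B(u, a) for HO and 0 = 2 B(u, a) for KO, so B(u, a) = 0.

For the dimensions, T lowers degree by 2, and an image of degree k is already the image of the
degree k + 2 part of its argument (`eq_apply_degProj`). Hence HO_{ξ-2} and KO_ξ are spanned by the
image of the top monomial. In KO that image has eigenvalue 2 under each T(x_i x_{i'}), so it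
contributes nothing to weight zero. The negative components in question consist of derivations with
constant coefficients. -/

theorem mon_of_lt {α : Fin n → ℕ} (h : ∀ i, α i < p ^ t i) (u : Finset (Fin m)) :
    (mon α u : O F p n m t) = bas (fun i => ⟨α i, h i⟩, u) := by
  simp [mon, h]

theorem mon_of_not_lt {α : Fin n → ℕ} (h : ¬ ∀ i, α i < p ^ t i) (u : Finset (Fin m)) :
    (mon α u : O F p n m t) = 0 := by
  simp only [mon, dif_neg h]

theorem expo_lt (a : Mono p n m t) (i : Fin n) : expo a i < p ^ t i := (a.1 i).2

theorem mon_expo (a : Mono p n m t) : (mon (expo a) a.2 : O F p n m t) = bas a := by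
  rw [mon_of_lt (expo_lt a)]
  rfl

@[simp]
theorem expo_mk (α : Fin n → ℕ) (h : ∀ i, α i < p ^ t i) (u : Finset (Fin m)) :
    expo ((fun i => ⟨α i, h i⟩, u) : Mono p n m t) = α := rfl

theorem O.induction {P : O F p n m t → Prop} (h0 : P 0) (hadd : ∀ f g, P f → P g → P (f + g))
    (hsmul : ∀ (c : F) f, P f → P (c • f)) (hbas : ∀ a, P (bas a)) (f : O F p n m t) : P f := by
  have hf : f ∈ Submodule.span F (Set.range (bas : Module.Basis (Mono p n m t) F _)) := by
    rw [bas.span_eq]; trivial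
  induction hf using Submodule.span_induction with
  | mem x h => obtain ⟨a, rfl⟩ := h; exact hbas a
  | zero => exact h0
  | add x y _ _ hx hy => exact hadd _ _ hx hy
  | smul c x _ hx => exact hsmul _ _ hx

/-- The structure constant of the divided power algebra. -/
def multichoose (α β : Fin n → ℕ) : ℕ := ∏ i, (α i + β i).choose (α i)

/-- No range condition is needed: if one exponent is out of range, so is the sum, and both sides
vanish. -/
theorem mul_mon_mon (α β : Fin n → ℕ) (u v : Finset (Fin m)) :
    mul (mon α u : O F p n m t) (mon β v) =
      if Disjoint u v then
        ((-1 : F) ^ inversions u v * (multichoose α β : F)) • mon (α + β) (u ∪ v)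
      else 0 := by
  by_cases hα : ∀ i, α i < p ^ t i
  · by_cases hβ : ∀ i, β i < p ^ t i
    · rw [mon_of_lt hα, mon_of_lt hβ]
      simp only [mul, Module.Basis.constr_basis, expo_mk]
      rfl
    · rw [mon_of_not_lt hβ, mon_of_not_lt (α := α + β)]
      · simp
      · contrapose! hβ
        exact fun i => (Nat.le_add_left _ _).trans_lt (hβ i)
  · rw [mon_of_not_lt hα, mon_of_not_lt (α := α + β)]
    · simp
    · contrapose! hα
      exact fun i => (Nat.le_add_right _ _).trans_lt (hα i)

theorem inversions_union_left {u v : Finset (Fin m)} (h : Disjoint u v) (w : Finset (Fin m)) :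
    inversions (u ∪ v) w = inversions u w + inversions v w := by
  rw [inversions, Finset.union_product, Finset.filter_union, Finset.card_union_of_disjoint]
  · rfl
  · exact Finset.disjoint_filter_filter (Finset.disjoint_product.2 (Or.inl h))

theorem inversions_union_right {v w : Finset (Fin m)} (h : Disjoint v w) (u : Finset (Fin m)) :
    inversions u (v ∪ w) = inversions u v + inversions u w := by
  rw [inversions, Finset.product_union, Finset.filter_union, Finset.card_union_of_disjoint]
  · rfl
  · exact Finset.disjoint_filter_filter (Finset.disjoint_product.2 (Or.inr h))

/-- For disjoint sets every pair of `u ×ˢ v` is an inversion in exactly one of the two orders. This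
is the source of the supercommutativity sign. -/
theorem inversions_add_swap {u v : Finset (Fin m)} (h : Disjoint u v) :
    inversions u v + inversions v u = u.card * v.card := by
  have : inversions v u = ((u ×ˢ v).filter fun q => ¬ q.2 < q.1).card := by
    refine Finset.card_bij' (fun q _ => q.swap) (fun q _ => q.swap) ?_ ?_ ?_ ?_
    · rintro ⟨a, b⟩ hab
      simp only [Finset.mem_filter, Finset.mem_product, Prod.swap, not_lt] at hab ⊢
      exact ⟨⟨hab.1.2, hab.1.1⟩, hab.2.le⟩
    · rintro ⟨a, b⟩ hab
      simp only [Finset.mem_filter, Finset.mem_product, Prod.swap, not_lt] at hab ⊢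
      refine ⟨⟨hab.1.2, hab.1.1⟩, lt_of_le_of_ne hab.2 ?_⟩
      exact fun e => Finset.disjoint_left.1 h hab.1.1 (e ▸ hab.1.2)
    · simp
    · simp
  rw [this, inversions, Finset.card_filter_add_card_filter_not, Finset.card_product]

/-- In each coordinate both sides are the multinomial coefficient (α+β+γ)!/(α! β! γ!). -/
theorem multichoose_assoc (α β γ : Fin n → ℕ) :
    multichoose α β * multichoose (α + β) γ = multichoose β γ * multichoose α (β + γ) := by
  simp only [multichoose, ← Finset.prod_mul_distrib]
  refine Finset.prod_congr rfl fun i _ => ?_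
  simp only [Pi.add_apply]
  have h1 := Nat.add_choose_mul_factorial_mul_factorial (α i) (β i)
  have h2 := Nat.add_choose_mul_factorial_mul_factorial (α i + β i) (γ i)
  have h3 := Nat.add_choose_mul_factorial_mul_factorial (β i) (γ i)
  have h4 := Nat.add_choose_mul_factorial_mul_factorial (α i) (β i + γ i)
  rw [← Nat.choose_symm_add] at h1 h2 h3 h4
  have hp : 0 < (α i).factorial * (β i).factorial * (γ i).factorial := by positivity
  refine Nat.eq_of_mul_eq_mul_right hp ?_
  calc _ = ((α i + β i).choose (α i) * (α i).factorial * (β i).factorial) *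
          (α i + β i + γ i).choose (α i + β i) * (γ i).factorial := by ring
    _ = ((α i + (β i + γ i)).choose (α i) * (α i).factorial * ((β i + γ i).choose (β i) *
          (β i).factorial * (γ i).factorial)) := by
        rw [h1, h3, h4, ← add_assoc, ← h2]; ring
    _ = _ := by ring

theorem multichoose_comm (α β : Fin n → ℕ) : multichoose α β = multichoose β α := by
  refine Finset.prod_congr rfl fun i _ => ?_
  rw [add_comm (β i), Nat.choose_symm_add]

theorem mul_assoc_mon (α β γ : Fin n → ℕ) (u v w : Finset (Fin m)) :
    mul (mul (mon α u : O F p n m t) (mon β v)) (mon γ w) =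
      mul (mon α u) (mul (mon β v) (mon γ w)) := by
  rw [mul_mon_mon, mul_mon_mon β]
  by_cases huv : Disjoint u v
  · by_cases hvw : Disjoint v w
    · simp only [huv, hvw, if_true, map_smul, LinearMap.smul_apply, mul_mon_mon,
        Finset.disjoint_union_left, Finset.disjoint_union_right, true_and, and_true]
      split_ifs with huw
      · rw [smul_smul, smul_smul, inversions_union_left huv, inversions_union_right hvw,
          add_assoc α, Finset.union_assoc]
        congr 1
        have := congrArg (Nat.cast : ℕ → F) (multichoose_assoc α β γ)
        push_cast at this
        simp only [pow_add]
        linear_combination (-1 : F) ^ inversions u v * (-1 : F) ^ inversions u w *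
          (-1 : F) ^ inversions v w * this
      · simp
    · simp [huv, hvw, mul_mon_mon, Finset.disjoint_union_left]
  · by_cases hvw : Disjoint v w
    · simp [huv, hvw, mul_mon_mon, Finset.disjoint_union_right]
    · simp [huv, hvw]

theorem mul_assoc' (f g h : O F p n m t) : mul (mul f g) h = mul f (mul g h) := by
  induction f using O.induction with
  | h0 => simp
  | hadd f f' hf hf' => simp only [map_add, LinearMap.add_apply, hf, hf']
  | hsmul c f hf => simp only [map_smul, LinearMap.smul_apply, hf]
  | hbas a =>
    induction g using O.induction with
    | h0 => simp
    | hadd f f' hf hf' => simp only [map_add, LinearMap.add_apply, hf, hf']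
    | hsmul c f hf => simp only [map_smul, LinearMap.smul_apply, hf]
    | hbas b =>
      induction h using O.induction with
      | h0 => simp
      | hadd f f' hf hf' => simp only [map_add, hf, hf']
      | hsmul c f hf => simp only [map_smul, hf]
      | hbas c =>
        rw [← mon_expo a, ← mon_expo b, ← mon_expo c]
        exact mul_assoc_mon _ _ _ _ _ _

noncomputable instance : Mul (O F p n m t) := ⟨fun f g => mul f g⟩

theorem mul_apply (f g : O F p n m t) : mul f g = f * g := rfl

noncomputable instance : NonUnitalRing (O F p n m t) where
  left_distrib f g h := by simp only [← mul_apply, map_add]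
  right_distrib f g h := by simp only [← mul_apply, map_add, LinearMap.add_apply]
  zero_mul f := by simp only [← mul_apply, map_zero, LinearMap.zero_apply]
  mul_zero f := by simp only [← mul_apply, map_zero]
  mul_assoc := mul_assoc'


instance : IsScalarTower F (O F p n m t) (O F p n m t) :=
  ⟨fun c f g => by simp only [smul_eq_mul, ← mul_apply, map_smul, LinearMap.smul_apply]⟩

instance : SMulCommClass F (O F p n m t) (O F p n m t) :=
  ⟨fun c f g => by simp only [smul_eq_mul, ← mul_apply, map_smul]⟩

theorem mon_mul_mon (α β : Fin n → ℕ) (u v : Finset (Fin m)) :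
    (mon α u : O F p n m t) * mon β v =
      if Disjoint u v then
        ((-1 : F) ^ inversions u v * (multichoose α β : F)) • mon (α + β) (u ∪ v)
      else 0 := mul_mon_mon α β u v

theorem mul_mul (f g : O F p n m t) : mul f * mul g = mul (f * g) :=
  LinearMap.ext fun h => (mul_assoc f g h).symm

theorem multichoose_zero_right (α : Fin n → ℕ) : multichoose α 0 = 1 := by
  simp [multichoose]

theorem mul_mon_zero (f : O F p n m t) : f * mon 0 ∅ = f := by
  induction f using O.induction with
  | h0 => simp
  | hadd f f' hf hf' => rw [add_mul, hf, hf']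
  | hsmul c f hf => rw [smul_mul_assoc, hf]
  | hbas a =>
    rw [← mon_expo a, mon_mul_mon]
    simp [multichoose_zero_right, inversions]

theorem mon_zero_mul (f : O F p n m t) : mon 0 ∅ * f = f := by
  induction f using O.induction with
  | h0 => simp
  | hadd f f' hf hf' => rw [mul_add, hf, hf']
  | hsmul c f hf => rw [mul_smul_comm, hf]
  | hbas a =>
    rw [← mon_expo a, mon_mul_mon]
    simp [multichoose_comm 0, multichoose_zero_right, inversions]

theorem mul_mon_zero_eq_one : mul (mon 0 ∅ : O F p n m t) = 1 :=
  LinearMap.ext mon_zero_mul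

theorem bas_mul_bas_comm (a b : Mono p n m t) :
    (bas b * bas a : O F p n m t) = (-1 : F) ^ (a.2.card * b.2.card) • (bas a * bas b) := by
  rw [← mon_expo a, ← mon_expo b, mon_mul_mon, mon_mul_mon]
  by_cases h : Disjoint a.2 b.2
  · rw [if_pos h, if_pos h.symm, smul_smul, ← inversions_add_swap h, pow_add,
      multichoose_comm (expo b), add_comm (expo b), Finset.union_comm]
    congr 1
    have : ((-1 : F) ^ inversions a.2 b.2) * (-1) ^ inversions a.2 b.2 = 1 := by
      rw [← pow_add, ← two_mul, pow_mul]; simp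
    linear_combination -((-1 : F) ^ inversions b.2 a.2 * (multichoose (expo a) (expo b) : F)) * this
  · rw [if_neg h, if_neg fun h' => h h'.symm, smul_zero]

end Algebra

/-! ### The partial derivatives: Leibniz rules and commutation. -/

section Derivations

variable {F : Type*} [Field F] {p n m : ℕ} {t : Fin n → ℕ}

/-- Only the i-th exponent must be in range. If another one is out of range both sides vanish, but
for exponent `p ^ t i` in the i-th place the right side could survive while the left is zero. -/
theorem dEven_mon {α : Fin n → ℕ} {i : Fin n} (h : α i < p ^ t i) (u : Finset (Fin m)) :
    dEven i (mon α u : O F p n m t) = if α i = 0 then 0 else mon (α - Pi.single i 1) u := by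
  by_cases hα : ∀ i, α i < p ^ t i
  · rw [mon_of_lt hα, dEven, Module.Basis.constr_basis, expo_mk]
  · rw [mon_of_not_lt hα, map_zero, mon_of_not_lt, ite_self]
    contrapose! hα
    intro j
    by_cases hj : j = i
    · exact hj ▸ h
    · simpa [hj] using hα j

theorem dOdd_mon (α : Fin n → ℕ) (j : Fin m) (u : Finset (Fin m)) :
    dOdd j (mon α u : O F p n m t) =
      if j ∈ u then (-1 : F) ^ (u.filter (· < j)).card • mon α (u.erase j) else 0 := by
  by_cases hα : ∀ i, α i < p ^ t i
  · rw [mon_of_lt hα, dOdd, Module.Basis.constr_basis, expo_mk]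
  · rw [mon_of_not_lt hα, mon_of_not_lt hα, map_zero, smul_zero, ite_self]

theorem multichoose_eq_mul_prod_erase (α β : Fin n → ℕ) (i : Fin n) :
    multichoose α β = (α i + β i).choose (α i) *
      ∏ j ∈ Finset.univ.erase i, (α j + β j).choose (α j) :=
  (Finset.mul_prod_erase _ _ (Finset.mem_univ i)).symm

theorem prod_erase_sub_single (α β : Fin n → ℕ) (i : Fin n) :
    (∏ j ∈ Finset.univ.erase i, ((α - Pi.single i 1 : Fin n → ℕ) j + β j).choose
        ((α - Pi.single i 1 : Fin n → ℕ) j)) =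
      ∏ j ∈ Finset.univ.erase i, (α j + β j).choose (α j) := by
  refine Finset.prod_congr rfl fun j hj => ?_
  simp [Finset.ne_of_mem_erase hj]

theorem multichoose_pascal {α β : Fin n → ℕ} {i : Fin n} (hα : α i ≠ 0) (hβ : β i ≠ 0) :
    multichoose α β =
      multichoose (α - Pi.single i 1) β + multichoose α (β - Pi.single i 1) := by
  rw [multichoose_comm α (β - Pi.single i 1), multichoose_eq_mul_prod_erase _ _ i,
    multichoose_eq_mul_prod_erase (α - _) _ i, multichoose_eq_mul_prod_erase (β - _) _ i,
    prod_erase_sub_single, prod_erase_sub_single]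
  have h : ∏ j ∈ Finset.univ.erase i, (β j + α j).choose (β j) =
      ∏ j ∈ Finset.univ.erase i, (α j + β j).choose (α j) :=
    Finset.prod_congr rfl fun j _ => by rw [add_comm (β j), Nat.choose_symm_add]
  rw [h, ← add_mul]
  congr 1
  obtain ⟨a, ha⟩ := Nat.exists_eq_succ_of_ne_zero hα
  obtain ⟨b, hb⟩ := Nat.exists_eq_succ_of_ne_zero hβ
  simp only [Pi.sub_apply, Pi.single_eq_same, ha, hb, Nat.succ_sub_one, Nat.succ_eq_add_one]
  rw [show a + 1 + (b + 1) = a + b + 1 + 1 by ring, Nat.choose_succ_succ,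
    show a + (b + 1) = a + b + 1 by ring, show b + (a + 1) = a + b + 1 by ring]
  congr 1
  rw [show a + b + 1 = (a + 1) + b by ring, Nat.choose_symm_add]

theorem multichoose_of_eq_zero {α : Fin n → ℕ} {i : Fin n} (hα : α i = 0) (β : Fin n → ℕ) :
    multichoose α β = multichoose α (β - Pi.single i 1) := by
  rw [multichoose_comm α β, multichoose_comm α (β - Pi.single i 1),
    multichoose_eq_mul_prod_erase _ _ i, multichoose_eq_mul_prod_erase (β - _) _ i,
    prod_erase_sub_single]
  simp [hα]

/-- This is where characteristic p enters the Leibniz rule. If α_i + β_i = p^{t_i}, truncation makes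
x^(α+β) zero although x^(α+β-ε_i) need not be. Both exponents are then positive, so p divides the
binomial coefficient and both sides vanish. -/
theorem multichoose_smul_dEven_mon [CharP F p] (hp : p.Prime) {α β : Fin n → ℕ} {i : Fin n}
    (hα : α i < p ^ t i) (hβ : β i < p ^ t i) (w : Finset (Fin m)) :
    (multichoose α β : F) • dEven i (mon (α + β) w : O F p n m t) =
      (multichoose α β : F) •
        if α i + β i = 0 then 0 else mon (α + β - Pi.single i 1) w := by
  rcases lt_trichotomy (α i + β i) (p ^ t i) with h | h | h
  · rw [dEven_mon (by exact h)]
    rfl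
  · have h0 : (multichoose α β : F) = 0 := by
      rw [multichoose_eq_mul_prod_erase _ _ i, h, Nat.cast_mul,
        (CharP.cast_eq_zero_iff F p _).2 (hp.dvd_choose_pow (by omega) (by omega)), zero_mul]
    rw [h0, zero_smul, zero_smul]
  · rw [mon_of_not_lt, mon_of_not_lt, map_zero, ite_self]
    · intro h'
      have := h' i
      simp only [Pi.sub_apply, Pi.add_apply, Pi.single_eq_same] at this
      omega
    · intro h'
      have := h' i
      simp only [Pi.add_apply] at this
      omega

theorem dEven_mul [CharP F p] (hp : p.Prime) (i : Fin n) (f g : O F p n m t) :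
    dEven i (f * g) = dEven i f * g + f * dEven i g := by
  induction f using O.induction with
  | h0 => simp
  | hadd f f' hf hf' => simp only [map_add, add_mul, hf, hf']; abel
  | hsmul c f hf => simp only [map_smul, smul_mul_assoc, hf, smul_add]
  | hbas a =>
    induction g using O.induction with
    | h0 => simp
    | hadd f f' hf hf' => simp only [map_add, mul_add, hf, hf']; abel
    | hsmul c f hf => simp only [map_smul, mul_smul_comm, hf, smul_add]
    | hbas b =>
      rw [← mon_expo a, ← mon_expo b]
      have hα := expo_lt a
      have hβ := expo_lt b
      generalize expo a = α at *
      generalize expo b = β at *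
      generalize a.2 = u
      generalize b.2 = v
      rw [mon_mul_mon, dEven_mon (hα i), dEven_mon (hβ i)]
      by_cases huv : Disjoint u v
      · rw [if_pos huv, mul_smul, map_smul, map_smul, multichoose_smul_dEven_mon hp (hα i) (hβ i)]
        by_cases ha : α i = 0 <;> by_cases hb : β i = 0
        · simp [ha, hb]
        · have h1 : α + β - Pi.single i 1 = α + (β - Pi.single i 1) := by
            ext j; by_cases hj : j = i
            · subst hj; simp; omega
            · simp [hj]
          simp [ha, hb, mon_mul_mon, huv, multichoose_of_eq_zero ha β, smul_smul, h1]
        · have h1 : α + β - Pi.single i 1 = (α - Pi.single i 1) + β := by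
            ext j; by_cases hj : j = i
            · subst hj; simp; omega
            · simp [hj]
          rw [multichoose_comm, multichoose_of_eq_zero hb α, multichoose_comm]
          simp [ha, hb, mon_mul_mon, huv, smul_smul, h1]
        · have h1 : α + β - Pi.single i 1 = α + (β - Pi.single i 1) := by
            ext j; by_cases hj : j = i
            · subst hj; simp; omega
            · simp [hj]
          have h2 : α + β - Pi.single i 1 = (α - Pi.single i 1) + β := by
            ext j; by_cases hj : j = i
            · subst hj; simp; omega
            · simp [hj]
          -- With both exponents positive, the Leibniz rule is Pascal's identity in the i-th
          -- coordinate.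
          rw [if_neg ha, if_neg hb, if_neg (by omega), mon_mul_mon, mon_mul_mon, if_pos huv,
            if_pos huv, ← h1, ← h2, multichoose_pascal ha hb]
          push_cast
          module
      · split_ifs <;> simp [mon_mul_mon, huv]

theorem inversions_singleton_left (j : Fin m) (v : Finset (Fin m)) :
    inversions {j} v = (v.filter (· < j)).card := by
  rw [inversions, Finset.singleton_product, Finset.filter_map, Finset.card_map]
  rfl

theorem inversions_singleton_add {u : Finset (Fin m)} {j : Fin m} (h : j ∉ u) :
    inversions u {j} + (u.filter (· < j)).card = u.card := by
  rw [← inversions_singleton_left, inversions_add_swap (by simpa using h), Finset.card_singleton,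
    mul_one]

theorem card_filter_lt_union {u v : Finset (Fin m)} (h : Disjoint u v) (j : Fin m) :
    ((u ∪ v).filter (· < j)).card = (u.filter (· < j)).card + (v.filter (· < j)).card := by
  rw [Finset.filter_union, Finset.card_union_of_disjoint (Finset.disjoint_filter_filter h)]

theorem card_filter_lt_insert (u : Finset (Fin m)) (j : Fin m) :
    ((insert j u).filter (· < j)).card = (u.filter (· < j)).card := by
  rw [Finset.filter_insert, if_neg (lt_irrefl j)]

theorem inversions_insert_left {u : Finset (Fin m)} {j : Fin m} (h : j ∉ u)
    (v : Finset (Fin m)) :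
    inversions (insert j u) v = (v.filter (· < j)).card + inversions u v := by
  rw [Finset.insert_eq, inversions_union_left (by simpa using h), inversions_singleton_left]

theorem inversions_insert_right {v : Finset (Fin m)} {j : Fin m} (h : j ∉ v)
    (u : Finset (Fin m)) :
    inversions u (insert j v) = inversions u {j} + inversions u v := by
  rw [Finset.insert_eq, inversions_union_right (by simpa using h)]

theorem neg_one_pow_mul_self (k : ℕ) : (-1 : F) ^ k * (-1) ^ k = 1 := by
  rw [← mul_pow]; simp

/-- The cases are whether x_j occurs in each factor. If it occurs in both, the product is zero and
the two Leibniz terms are the same monomial with opposite signs. Otherwise at most one term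
survives, and its sign is obtained by counting the variables that x_j has to pass. -/
theorem dOdd_mul_mon (α β : Fin n → ℕ) (u v : Finset (Fin m)) (j : Fin m) :
    dOdd j (mon α u * mon β v : O F p n m t) =
      dOdd j (mon α u) * mon β v + (-1 : F) ^ u.card • (mon α u * dOdd j (mon β v)) := by
  rw [mon_mul_mon, dOdd_mon, dOdd_mon]
  by_cases hu : j ∈ u <;> by_cases hv : j ∈ v
  · obtain ⟨u, hu', rfl⟩ : ∃ u', j ∉ u' ∧ u = insert j u' :=
      ⟨u.erase j, by simp, (Finset.insert_erase hu).symm⟩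
    obtain ⟨v, hv', rfl⟩ : ∃ v', j ∉ v' ∧ v = insert j v' :=
      ⟨v.erase j, by simp, (Finset.insert_erase hv).symm⟩
    rw [if_neg (by simp)]
    simp only [Finset.mem_insert_self, if_true, Finset.erase_insert hu', Finset.erase_insert hv',
      card_filter_lt_insert, smul_mul_assoc, mul_smul_comm, mon_mul_mon,
      Finset.disjoint_insert_left, Finset.disjoint_insert_right, hu', hv', not_false_eq_true,
      true_and, Finset.insert_union, Finset.union_insert, map_zero]
    split_ifs
    · rw [inversions_insert_right hv', inversions_insert_left hu', smul_smul, smul_smul, smul_smul,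
        ← add_smul, Finset.card_insert_of_notMem hu', ← inversions_singleton_add hu']
      convert (zero_smul F _).symm
      simp only [pow_add, pow_one]
      linear_combination -(-1 : F) ^ (u.filter (· < j)).card * (-1) ^ inversions u {j} *
        (-1) ^ inversions u v * (multichoose α β : F) *
          neg_one_pow_mul_self (F := F) (v.filter (· < j)).card
    · simp
  · obtain ⟨u, hu', rfl⟩ : ∃ u', j ∉ u' ∧ u = insert j u' :=
      ⟨u.erase j, by simp, (Finset.insert_erase hu).symm⟩
    simp only [Finset.mem_insert_self, if_true, Finset.erase_insert hu', hv, if_false, mul_zero,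
      smul_zero, add_zero, card_filter_lt_insert, smul_mul_assoc, mon_mul_mon,
      Finset.disjoint_insert_left, not_false_eq_true, true_and]
    split_ifs with h
    · rw [map_smul, dOdd_mon, if_pos (by simp), smul_smul, smul_smul, inversions_insert_left hu',
        Finset.insert_union, Finset.erase_insert (by simp [hu', hv]), card_filter_lt_insert,
        card_filter_lt_union h]
      congr 1
      simp only [pow_add]
      linear_combination (-1 : F) ^ (u.filter (· < j)).card *
        (-1) ^ inversions u v * (multichoose α β : F) *
          neg_one_pow_mul_self (F := F) (v.filter (· < j)).card
    · simp
  · obtain ⟨v, hv', rfl⟩ : ∃ v', j ∉ v' ∧ v = insert j v' :=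
      ⟨v.erase j, by simp, (Finset.insert_erase hv).symm⟩
    simp only [Finset.mem_insert_self, if_true, Finset.erase_insert hv', hu, if_false, zero_mul,
      zero_add, card_filter_lt_insert, mul_smul_comm, mon_mul_mon,
      Finset.disjoint_insert_right, not_false_eq_true, true_and]
    split_ifs with h
    · rw [map_smul, dOdd_mon, if_pos (by simp), smul_smul, smul_smul, smul_smul,
        inversions_insert_right hv',
        Finset.union_insert, Finset.erase_insert (by simp [hv', hu]), card_filter_lt_insert,
        card_filter_lt_union h, ← inversions_singleton_add hu]
      congr 1
      simp only [pow_add]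
      ring
    · simp
  · rw [if_neg hu, if_neg hv]
    split_ifs
    · rw [map_smul, dOdd_mon, if_neg (by simp [hu, hv])]
      simp
    · simp

/-- The parity automorphism. -/
noncomputable def parity : Module.End F (O F p n m t) :=
  bas.constr F fun a => (-1 : F) ^ a.2.card • bas a

theorem parity_bas (a : Mono p n m t) :
    parity (bas a : O F p n m t) = (-1 : F) ^ a.2.card • bas a := by
  rw [parity, Module.Basis.constr_basis]

theorem parity_mon (α : Fin n → ℕ) (u : Finset (Fin m)) :
    parity (mon α u : O F p n m t) = (-1 : F) ^ u.card • mon α u := by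
  by_cases hα : ∀ i, α i < p ^ t i
  · rw [mon_of_lt hα, parity_bas]
  · rw [mon_of_not_lt hα, map_zero, smul_zero]

theorem dOdd_mul (j : Fin m) (f g : O F p n m t) :
    dOdd j (f * g) = dOdd j f * g + parity f * dOdd j g := by
  induction f using O.induction with
  | h0 => simp
  | hadd f f' hf hf' => simp only [map_add, add_mul, hf, hf']; abel
  | hsmul c f hf => simp only [map_smul, smul_mul_assoc, hf, smul_add]
  | hbas a =>
    induction g using O.induction with
    | h0 => simp
    | hadd f f' hf hf' => simp only [map_add, mul_add, hf, hf']; abel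
    | hsmul c f hf => simp only [map_smul, mul_smul_comm, hf, smul_add]
    | hbas b =>
      rw [← mon_expo a, ← mon_expo b, dOdd_mul_mon, parity_mon, smul_mul_assoc]

theorem dEven_comm (i j : Fin n) (f : O F p n m t) :
    dEven i (dEven j f) = dEven j (dEven i f) := by
  induction f using O.induction with
  | h0 => simp
  | hadd f f' hf hf' => simp only [map_add, hf, hf']
  | hsmul c f hf => simp only [map_smul, hf]
  | hbas a =>
    have h (i : Fin n) : (expo a - Pi.single j 1 : Fin n → ℕ) i < p ^ t i :=
      (Nat.sub_le _ _).trans_lt (expo_lt a i)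
    have h' (j : Fin n) : (expo a - Pi.single i 1 : Fin n → ℕ) j < p ^ t j :=
      (Nat.sub_le _ _).trans_lt (expo_lt a j)
    rw [← mon_expo a, dEven_mon (expo_lt a j), dEven_mon (expo_lt a i)]
    by_cases hij : i = j
    · subst hij; rfl
    · rw [apply_ite (dEven i), apply_ite (dEven j), dEven_mon (h i), dEven_mon (h' j)]
      simp only [map_zero, Pi.sub_apply, Pi.single_eq_of_ne hij, Pi.single_eq_of_ne' hij, tsub_zero,
        tsub_right_comm (b := Pi.single i 1)]
      split_ifs <;> rfl

theorem dEven_dOdd (i : Fin n) (j : Fin m) (f : O F p n m t) :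
    dEven i (dOdd j f) = dOdd j (dEven i f) := by
  induction f using O.induction with
  | h0 => simp
  | hadd f f' hf hf' => simp only [map_add, hf, hf']
  | hsmul c f hf => simp only [map_smul, hf]
  | hbas a =>
    rw [← mon_expo a, dEven_mon (expo_lt a i), dOdd_mon, apply_ite (dOdd j), dOdd_mon,
      apply_ite (dEven i), map_smul, dEven_mon (expo_lt a i)]
    split_ifs <;> simp

theorem dOdd_dOdd_self (j : Fin m) (f : O F p n m t) : dOdd j (dOdd j f) = 0 := by
  induction f using O.induction with
  | h0 => simp
  | hadd f f' hf hf' => simp only [map_add, hf, hf', add_zero]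
  | hsmul c f hf => simp only [map_smul, hf, smul_zero]
  | hbas a =>
    rw [← mon_expo a, dOdd_mon, apply_ite (dOdd j), map_smul, dOdd_mon]
    simp

/-- Removing the larger index k leaves the number of indices below j unchanged, whereas removing j
lowers the number below k by one. This accounts for the sign. -/
theorem dOdd_anticomm_mon_of_lt (α : Fin n → ℕ) (u : Finset (Fin m)) {j k : Fin m} (h : j < k) :
    dOdd j (dOdd k (mon α u : O F p n m t)) = -dOdd k (dOdd j (mon α u)) := by
  rw [dOdd_mon, dOdd_mon, apply_ite (dOdd j), apply_ite (dOdd k), map_smul, map_smul, dOdd_mon,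
    dOdd_mon]
  by_cases hj : j ∈ u <;> by_cases hk : k ∈ u
  · have h1 : ((u.erase k).filter (· < j)).card = (u.filter (· < j)).card := by
      rw [Finset.filter_erase, Finset.erase_eq_of_notMem]
      simp [h.le]
    have h2 : ((u.erase j).filter (· < k)).card + 1 = (u.filter (· < k)).card := by
      rw [Finset.filter_erase, Finset.card_erase_add_one]
      simp [h, hj]
    rw [if_pos hk, if_pos hj, if_pos (by simp [hj, h.ne]), if_pos (by simp [hk, h.ne']), h1, ← h2,
      Finset.erase_right_comm, pow_succ]
    module
  · simp [hk]
  · simp [hj]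
  · simp [hj, hk]

theorem dOdd_anticomm (j k : Fin m) (f : O F p n m t) :
    dOdd j (dOdd k f) = -dOdd k (dOdd j f) := by
  induction f using O.induction with
  | h0 => simp
  | hadd f f' hf hf' => simp only [map_add, hf, hf', neg_add]
  | hsmul c f hf => simp only [map_smul, hf, smul_neg]
  | hbas a =>
    rcases lt_trichotomy j k with h | rfl | h
    · rw [← mon_expo a, dOdd_anticomm_mon_of_lt _ _ h]
    · rw [dOdd_dOdd_self, neg_zero]
    · rw [← mon_expo a, dOdd_anticomm_mon_of_lt _ _ h, neg_neg]

end Derivations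

/-! ### The bracket formula for an abstract contact frame. -/

section ContactFrame

variable {R : Type*} [NonUnitalRing R]

/-- An even superderivation, with respect to the predicates `E` (even) and `O` (odd). -/
structure IsEvenDer (E O : R → Prop) (X : R →+ R) : Prop where
  map_even : ∀ f, E f → E (X f)
  map_odd : ∀ f, O f → O (X f)
  leibniz : ∀ f g, X (f * g) = X f * g + f * X g

/-- An odd superderivation, with respect to the predicates `E` (even) and `O` (odd). -/
structure IsOddDer (E O : R → Prop) (Y : R →+ R) : Prop where
  map_even : ∀ f, E f → O (Y f)
  map_odd : ∀ f, O f → E (Y f)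
  leibniz_even : ∀ f g, E f → Y (f * g) = Y f * g + f * Y g
  leibniz_odd : ∀ f g, O f → Y (f * g) = Y f * g - f * Y g

/-- The summand of the contact operator that belongs to a pair of conjugate derivations. -/
def pairOp (X Y : R →+ R) (s : ℤ) (f w : R) : R := X f * Y w + s • (Y f * X w)

/-- Expand by the Leibniz rules. Terms of second order in w or in b cancel inside one bracketed
expression, because different pairs supercommute; terms of second order in a cancel only against the
expression with the pairs exchanged. The sign κ is (-1)^{p(Ta) p(Tb)}, where T reverses parity, and
-(s s') is the parity sign of c(a, b). The primed predicates, later equal to the unprimed ones, mark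
factors that come from b, so that the sorting rules move factors of a to the left and never back. -/
theorem pairOp_bracket_offdiag {X Y X' Y' : R →+ R} {E O E' O' : R → Prop}
    (hX : IsEvenDer E O X) (hX' : IsEvenDer E O X') (hY : IsOddDer E O Y) (hY' : IsOddDer E O Y')
    (kX : IsEvenDer E' O' X) (kX' : IsEvenDer E' O' X') (kY : IsOddDer E' O' Y)
    (kY' : IsOddDer E' O' Y')
    (hXX : ∀ f, X' (X f) = X (X' f))
    (hYX' : ∀ f, Y (X' f) = X' (Y f)) (hY'X : ∀ f, Y' (X f) = X (Y' f))
    (hYY : ∀ f, Y' (Y f) = -Y (Y' f))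
    (c00 : ∀ f g w, E f → E' g → g * (f * w) = f * (g * w))
    (c01 : ∀ f g w, E f → O' g → g * (f * w) = f * (g * w))
    (c10 : ∀ f g w, O f → E' g → g * (f * w) = f * (g * w))
    (c11 : ∀ f g w, O f → O' g → g * (f * w) = -(f * (g * w)))
    {a b : R} {s s' κ : ℤ}
    (h : (E a ∧ s = 1 ∧ E' b ∧ s' = 1 ∧ κ = -1) ∨ (E a ∧ s = 1 ∧ O' b ∧ s' = -1 ∧ κ = 1) ∨
      (O a ∧ s = -1 ∧ E' b ∧ s' = 1 ∧ κ = 1) ∨ (O a ∧ s = -1 ∧ O' b ∧ s' = -1 ∧ κ = 1)) (w : R) :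
    (pairOp X Y s a (pairOp X' Y' s' b w) - κ • pairOp X' Y' s' b (pairOp X Y s a w)
      - pairOp X' Y' (-(s * s')) (pairOp X Y s a b) w) +
    (pairOp X' Y' s a (pairOp X Y s' b w) - κ • pairOp X Y s' b (pairOp X' Y' s a w)
      - pairOp X Y (-(s * s')) (pairOp X' Y' s a b) w) = 0 := by
  -- The double negation keeps `simp` from treating this as a permutation lemma subject to its term
  -- order; it has to fire in this direction always.
  have d00 f g w (hf : E f) (hg : E' g) : g * (f * w) = - -(f * (g * w)) := by
    rw [c00 f g w hf hg, neg_neg]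
  have d01 f g w (hf : E f) (hg : O' g) : g * (f * w) = - -(f * (g * w)) := by
    rw [c01 f g w hf hg, neg_neg]
  have d10 f g w (hf : O f) (hg : E' g) : g * (f * w) = - -(f * (g * w)) := by
    rw [c10 f g w hf hg, neg_neg]
  rcases h with ⟨ha, rfl, hb, rfl, rfl⟩ | ⟨ha, rfl, hb, rfl, rfl⟩ | ⟨ha, rfl, hb, rfl, rfl⟩ |
    ⟨ha, rfl, hb, rfl, rfl⟩
  all_goals
    simp (maxDischargeDepth := 8) only [pairOp, map_add, map_neg, one_smul, neg_smul, mul_one,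
      neg_neg, mul_neg, neg_mul, mul_add, add_mul, mul_assoc, neg_add, sub_eq_add_neg,
      hX.leibniz, hX'.leibniz, hX.map_even, hX.map_odd, hX'.map_even, hX'.map_odd,
      hY.map_even, hY.map_odd, hY'.map_even, hY'.map_odd, hY.leibniz_even, hY.leibniz_odd,
      hY'.leibniz_even, hY'.leibniz_odd, kX.map_even, kX.map_odd, kX'.map_even, kX'.map_odd,
      kY.map_even, kY.map_odd, kY'.map_even, kY'.map_odd, kY.leibniz_even, kY.leibniz_odd,
      kY'.leibniz_even, kY'.leibniz_odd, hXX, hYX', hY'X, hYY, d00, d01, d10, c11, ha, hb]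
    abel

/-- The contributions to the bracket of two contact operators that involve one pair of conjugate
derivations only. -/
theorem pairOp_bracket_diag {X Y Z : R →+ R} {E O E' O' : R → Prop}
    (hX : IsEvenDer E O X) (hY : IsOddDer E O Y) (hZ : IsOddDer E O Z)
    (kX : IsEvenDer E' O' X) (kY : IsOddDer E' O' Y) (kZ : IsOddDer E' O' Z)
    (hYX : ∀ f, Y (X f) = X (Y f) - (2 : ℤ) • Z f)
    (hYY : ∀ f, Y (Y f) = 0) (hZX : ∀ f, Z (X f) = X (Z f)) (hZY : ∀ f, Z (Y f) = -Y (Z f))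
    (c00 : ∀ f g w, E f → E' g → g * (f * w) = f * (g * w))
    (c01 : ∀ f g w, E f → O' g → g * (f * w) = f * (g * w))
    (c10 : ∀ f g w, O f → E' g → g * (f * w) = f * (g * w))
    (c11 : ∀ f g w, O f → O' g → g * (f * w) = -(f * (g * w)))
    {a b : R} {s s' κ : ℤ}
    (h : (E a ∧ s = 1 ∧ E' b ∧ s' = 1 ∧ κ = -1) ∨ (E a ∧ s = 1 ∧ O' b ∧ s' = -1 ∧ κ = 1) ∨
      (O a ∧ s = -1 ∧ E' b ∧ s' = 1 ∧ κ = 1) ∨ (O a ∧ s = -1 ∧ O' b ∧ s' = -1 ∧ κ = 1)) (w : R) :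
    pairOp X Y s a (pairOp X Y s' b w) - κ • pairOp X Y s' b (pairOp X Y s a w)
      - pairOp X Y (-(s * s')) (pairOp X Y s a b) w
      + (- (2 : ℤ) • pairOp X Y s a (b * Z w) - (2 : ℤ) • (a * Z (pairOp X Y s' b w))
        + κ • ((2 : ℤ) • pairOp X Y s' b (a * Z w) + (2 : ℤ) • (b * Z (pairOp X Y s a w)))
        - pairOp X Y (-(s * s')) (- (2 : ℤ) • (a * Z b) - (2 * s) • (Z a * b)) w
        + (2 : ℤ) • (pairOp X Y s a b * Z w)) = 0 := by
  have d00 f g w (hf : E f) (hg : E' g) : g * (f * w) = - -(f * (g * w)) := by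
    rw [c00 f g w hf hg, neg_neg]
  have d01 f g w (hf : E f) (hg : O' g) : g * (f * w) = - -(f * (g * w)) := by
    rw [c01 f g w hf hg, neg_neg]
  have d10 f g w (hf : O f) (hg : E' g) : g * (f * w) = - -(f * (g * w)) := by
    rw [c10 f g w hf hg, neg_neg]
  rcases h with ⟨ha, rfl, hb, rfl, rfl⟩ | ⟨ha, rfl, hb, rfl, rfl⟩ | ⟨ha, rfl, hb, rfl, rfl⟩ |
    ⟨ha, rfl, hb, rfl, rfl⟩
  all_goals
    simp (maxDischargeDepth := 8) only [pairOp, map_add, map_neg, one_smul, neg_smul, mul_one,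
      neg_neg, mul_neg, neg_mul, mul_add, add_mul, mul_assoc, neg_add, sub_eq_add_neg, two_smul ℤ,
      add_zero, zero_add, zero_mul, neg_zero, mul_zero,
      hX.leibniz, hX.map_even, hX.map_odd,
      hY.map_even, hY.map_odd, hY.leibniz_even, hY.leibniz_odd,
      kX.map_even, kX.map_odd, kY.map_even, kY.map_odd, kY.leibniz_even, kY.leibniz_odd,
      hZ.map_even, hZ.map_odd, hZ.leibniz_even, hZ.leibniz_odd,
      kZ.leibniz_even, kZ.leibniz_odd,
      hYX, hYY, hZX, hZY, d00, d01, d10, c11, ha, hb]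
    abel

/-- These are the contributions in which only Z differentiates; Z² = 0 removes the second-order term
in w. -/
theorem pairOp_bracket_const {Z : R →+ R} {E O E' O' : R → Prop}
    (hZ : IsOddDer E O Z) (kZ : IsOddDer E' O' Z) (hZZ : ∀ f, Z (Z f) = 0)
    (c00 : ∀ f g w, E f → E' g → g * (f * w) = f * (g * w))
    (c01 : ∀ f g w, E f → O' g → g * (f * w) = f * (g * w))
    (c10 : ∀ f g w, O f → E' g → g * (f * w) = f * (g * w))
    (c11 : ∀ f g w, O f → O' g → g * (f * w) = -(f * (g * w)))
    {a b : R} {s s' κ : ℤ}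
    (h : (E a ∧ s = 1 ∧ E' b ∧ s' = 1 ∧ κ = -1) ∨ (E a ∧ s = 1 ∧ O' b ∧ s' = -1 ∧ κ = 1) ∨
      (O a ∧ s = -1 ∧ E' b ∧ s' = 1 ∧ κ = 1) ∨ (O a ∧ s = -1 ∧ O' b ∧ s' = -1 ∧ κ = 1)) (w : R) :
    (4 : ℤ) • (a * Z (b * Z w)) - κ • (4 : ℤ) • (b * Z (a * Z w))
      + (2 : ℤ) • ((- (2 : ℤ) • (a * Z b) - (2 * s) • (Z a * b)) * Z w) = 0 := by
  have d00 f g w (hf : E f) (hg : E' g) : g * (f * w) = - -(f * (g * w)) := by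
    rw [c00 f g w hf hg, neg_neg]
  have d01 f g w (hf : E f) (hg : O' g) : g * (f * w) = - -(f * (g * w)) := by
    rw [c01 f g w hf hg, neg_neg]
  have d10 f g w (hf : O f) (hg : E' g) : g * (f * w) = - -(f * (g * w)) := by
    rw [c10 f g w hf hg, neg_neg]
  rcases h with ⟨ha, rfl, hb, rfl, rfl⟩ | ⟨ha, rfl, hb, rfl, rfl⟩ | ⟨ha, rfl, hb, rfl, rfl⟩ |
    ⟨ha, rfl, hb, rfl, rfl⟩
  all_goals
    simp (maxDischargeDepth := 8) only [mul_one, one_smul, neg_smul, neg_neg, mul_neg, neg_mul,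
      smul_mul_assoc, add_mul, mul_assoc, sub_eq_add_neg, mul_zero, neg_zero, add_zero,
      hZ.map_even, hZ.map_odd, hZ.leibniz_even, hZ.leibniz_odd,
      kZ.leibniz_even, kZ.leibniz_odd,
      hZZ, d00, d01, d10, c11, ha, hb]
    abel

theorem pairOp_add_right (X Y : R →+ R) (s : ℤ) (f g h : R) :
    pairOp X Y s f (g + h) = pairOp X Y s f g + pairOp X Y s f h := by
  simp only [pairOp, map_add, mul_add, smul_add]; abel

theorem pairOp_add_left (X Y : R →+ R) (s : ℤ) (f g h : R) :
    pairOp X Y s (f + g) h = pairOp X Y s f h + pairOp X Y s g h := by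
  simp only [pairOp, map_add, add_mul, smul_add]; abel

variable {ι : Type*} [Fintype ι]

theorem pairOp_sum_right (X Y : R →+ R) (s : ℤ) (f : R) (g : ι → R) :
    pairOp X Y s f (∑ i, g i) = ∑ i, pairOp X Y s f (g i) := by
  simp only [pairOp, map_sum, Finset.mul_sum, Finset.smul_sum, Finset.sum_add_distrib]

theorem pairOp_sum_left (X Y : R →+ R) (s : ℤ) (f : ι → R) (g : R) :
    pairOp X Y s (∑ i, f i) g = ∑ i, pairOp X Y s (f i) g := by
  simp only [pairOp, map_sum, Finset.sum_mul, Finset.smul_sum, Finset.sum_add_distrib]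

theorem pairOp_smul_right (X Y : R →+ R) (s c : ℤ) (f g : R) :
    pairOp X Y s f (c • g) = c • pairOp X Y s f g := by
  simp only [pairOp, map_zsmul, mul_smul_comm, smul_add, smul_comm c s]

/-- Off-diagonal terms are paired by exchanging the indices, which avoids a division by 2. -/
theorem sum_sum_eq_sum_diag {M : Type*} [AddCommGroup M] (E : ι → ι → M)
    (h : ∀ i j, i ≠ j → E i j + E j i = 0) : ∑ i, ∑ j, E i j = ∑ i, E i i := by
  classical
  rw [← Finset.sum_product', ← Finset.diag_union_offDiag,
    Finset.sum_union (Finset.disjoint_diag_offDiag _), Finset.sum_diag, add_eq_left]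
  refine Finset.sum_involution (fun q _ => q.swap) ?_ ?_ ?_ ?_
  · intro q hq
    exact h q.1 q.2 (Finset.mem_offDiag.1 hq).2.2
  · intro q hq _ e
    exact (Finset.mem_offDiag.1 hq).2.2 (congrArg Prod.snd e)
  · intro q hq
    simpa [eq_comm] using hq
  · intro q _
    rfl

/-- A frame of superderivations for an odd contact structure (or, if `Z = 0`, an odd symplectic
structure) on a superalgebra with even and odd elements given by `E` and `O`. -/
structure IsContactFrame (E O : R → Prop) (X Y : ι → R →+ R) (Z : R →+ R) : Prop where
  even : ∀ i, IsEvenDer E O (X i)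
  odd : ∀ i, IsOddDer E O (Y i)
  reeb : IsOddDer E O Z
  X_X : ∀ i j f, X i (X j f) = X j (X i f)
  Y_X : ∀ i j f, i ≠ j → Y i (X j f) = X j (Y i f)
  Y_X_self : ∀ i f, Y i (X i f) = X i (Y i f) - (2 : ℤ) • Z f
  Y_Y : ∀ i j f, Y i (Y j f) = -Y j (Y i f)
  Y_Y_self : ∀ i f, Y i (Y i f) = 0
  Z_X : ∀ i f, Z (X i f) = X i (Z f)
  Z_Y : ∀ i f, Z (Y i f) = -Y i (Z f)
  Z_Z : ∀ f, Z (Z f) = 0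
  even_even : ∀ f g, E f → E g → g * f = f * g
  even_odd : ∀ f g, E f → O g → g * f = f * g
  odd_odd : ∀ f g, O f → O g → g * f = -(f * g)

/-- The operator attached to an element of parity sign `s` by a contact frame. -/
def contactOp (X Y : ι → R →+ R) (Z : R →+ R) (s : ℤ) (f w : R) : R :=
  ∑ i, pairOp (X i) (Y i) s f w - (2 : ℤ) • (f * Z w)

/-- The difference of the two sides splits by the derivations involved: terms with two pairs, terms
with one pair and Z, and terms with Z alone. The first kind reduces to its diagonal, where [Y_i,
X_i] = -2Z produces just what cancels the second kind; the third vanishes separately. -/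
theorem IsContactFrame.bracket {E O : R → Prop} {X Y : ι → R →+ R} {Z : R →+ R}
    (H : IsContactFrame E O X Y Z) {a b : R} {s s' κ : ℤ}
    (h : (E a ∧ s = 1 ∧ E b ∧ s' = 1 ∧ κ = -1) ∨ (E a ∧ s = 1 ∧ O b ∧ s' = -1 ∧ κ = 1) ∨
      (O a ∧ s = -1 ∧ E b ∧ s' = 1 ∧ κ = 1) ∨ (O a ∧ s = -1 ∧ O b ∧ s' = -1 ∧ κ = 1)) (w : R) :
    contactOp X Y Z s a (contactOp X Y Z s' b w)
        - κ • contactOp X Y Z s' b (contactOp X Y Z s a w) =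
      contactOp X Y Z (-(s * s')) (contactOp X Y Z s a b - (2 * s) • (Z a * b)) w := by
  have c00 f g w (hf : E f) (hg : E g) : g * (f * w) = f * (g * w) := by
    rw [← mul_assoc, H.even_even f g hf hg, mul_assoc]
  have c01 f g w (hf : E f) (hg : O g) : g * (f * w) = f * (g * w) := by
    rw [← mul_assoc, H.even_odd f g hf hg, mul_assoc]
  have c10 f g w (hf : O f) (hg : E g) : g * (f * w) = f * (g * w) := by
    rw [← mul_assoc, ← H.even_odd g f hg hf, mul_assoc]
  have c11 f g w (hf : O f) (hg : O g) : g * (f * w) = -(f * (g * w)) := by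
    rw [← mul_assoc, H.odd_odd f g hf hg, neg_mul, mul_assoc]
  set k := fun i => pairOp (X i) (Y i)
  -- The part of c(a, b) that involves Z alone: the term -2 a Z(b) of T(a)(b) together with the
  -- correction.
  set d := - (2 : ℤ) • (a * Z b) - (2 * s) • (Z a * b)
  let A (i j : ι) : R := k i s a (k j s' b w) - κ • k j s' b (k i s a w)
      - k j (-(s * s')) (k i s a b) w
  let B (i : ι) : R := - (2 : ℤ) • k i s a (b * Z w) - (2 : ℤ) • (a * Z (k i s' b w))
        + κ • ((2 : ℤ) • k i s' b (a * Z w) + (2 : ℤ) • (b * Z (k i s a w)))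
        - k i (-(s * s')) d w + (2 : ℤ) • (k i s a b * Z w)
  have hA : ∑ i, ∑ j, A i j = ∑ i, A i i := by
    refine sum_sum_eq_sum_diag A fun i j hij => ?_
    exact pairOp_bracket_offdiag (H.even i) (H.even j) (H.odd i) (H.odd j) (H.even i) (H.even j)
      (H.odd i) (H.odd j) (H.X_X j i) (fun f => H.Y_X i j f hij) (fun f => H.Y_X j i f hij.symm)
      (H.Y_Y j i) c00 c01 c10 c11 h w
  have hAB (i : ι) : A i i + B i = 0 :=
    pairOp_bracket_diag (H.even i) (H.odd i) H.reeb (H.even i) (H.odd i) H.reeb (H.Y_X_self i)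
      (H.Y_Y_self i) (H.Z_X i) (H.Z_Y i) c00 c01 c10 c11 h w
  have hC := pairOp_bracket_const H.reeb H.reeb H.Z_Z c00 c01 c10 c11 h w
  have hsum : ∑ i, ∑ j, A i j + ∑ i, B i = 0 := by
    rw [hA, ← Finset.sum_add_distrib, Finset.sum_eq_zero fun i _ => hAB i]
  have hc : contactOp X Y Z s a b - (2 * s) • (Z a * b) = ∑ i, k i s a b + d := by
    simp only [contactOp, k, d, neg_smul]; abel
  rw [hc, ← sub_eq_zero]
  -- It remains to see that the difference of the two sides is the sum of all `A i j`, all `B i` and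
  -- the Z-terms of `hC`, each group being accounted for already.
  refine Eq.trans ?_ ((congrArg₂ (fun x y : R => x + y) hsum hC).trans (add_zero 0))
  have e1 (s s' : ℤ) (a b w : R) : contactOp X Y Z s a (contactOp X Y Z s' b w) =
      ∑ i, ∑ j, k i s a (k j s' b w) - (2 : ℤ) • ∑ i, k i s a (b * Z w)
        - (2 : ℤ) • ∑ j, (a * Z (k j s' b w)) + (4 : ℤ) • (a * Z (b * Z w)) := by
    simp only [contactOp, k, sub_eq_add_neg, pairOp_add_right, pairOp_sum_right, ← neg_smul,
      pairOp_smul_right, Finset.sum_add_distrib, map_add, map_sum, mul_add, Finset.mul_sum,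
      map_zsmul, mul_smul_comm, smul_add, smul_smul, ← Finset.smul_sum]
    norm_num
    abel
  have e2 : contactOp X Y Z (-(s * s')) (∑ i, k i s a b + d) w =
      ∑ i, ∑ j, k j (-(s * s')) (k i s a b) w + ∑ i, k i (-(s * s')) d w
        - (2 : ℤ) • ∑ i, (k i s a b * Z w) - (2 : ℤ) • (d * Z w) := by
    rw [Finset.sum_comm]
    simp only [contactOp, k, pairOp_add_left, pairOp_sum_left, Finset.sum_add_distrib, add_mul,
      Finset.sum_mul, smul_add]
    abel
  have e3 : ∑ i, ∑ j, k i s' b (k j s a w) = ∑ i, ∑ j, k j s' b (k i s a w) := Finset.sum_comm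
  rw [e1, e1, e2, e3]
  simp only [A, B, Finset.sum_add_distrib, Finset.sum_sub_distrib, ← Finset.smul_sum, smul_sub,
    smul_add]
  module

end ContactFrame

/-! ### Parity of elements and operators, and the supercommutator. -/

section Parity

variable {F : Type*} [Field F] {p n m : ℕ} {t : Fin n → ℕ}

theorem projEven_bas (a : Mono p n m t) :
    projEven (bas a : O F p n m t) = if Even a.2.card then bas a else 0 := by
  rw [projEven, Module.Basis.constr_basis]

theorem projEven_mon (α : Fin n → ℕ) (u : Finset (Fin m)) :
    projEven (mon α u : O F p n m t) = if Even u.card then mon α u else 0 := by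
  by_cases hα : ∀ i, α i < p ^ t i
  · rw [mon_of_lt hα, projEven_bas]
  · rw [mon_of_not_lt hα, map_zero, ite_self]

theorem parity_eq (f : O F p n m t) : parity f = projEven f - (f - projEven f) := by
  induction f using O.induction with
  | h0 => simp
  | hadd f f' hf hf' => simp only [map_add, hf, hf']; abel
  | hsmul c f hf => simp only [map_smul, hf, smul_sub]
  | hbas a =>
    rw [parity_bas, projEven_bas]
    split_ifs with h
    · simp [h.neg_one_pow]
    · simp [(Nat.not_even_iff_odd.1 h).neg_one_pow]

theorem projEven_projEven (f : O F p n m t) : projEven (projEven f) = projEven f := by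
  induction f using O.induction with
  | h0 => simp
  | hadd f f' hf hf' => simp only [map_add, hf, hf']
  | hsmul c f hf => simp only [map_smul, hf]
  | hbas a =>
    rw [projEven_bas]
    split_ifs with h <;> simp [h, projEven_bas]

theorem projEven_dEven (i : Fin n) (f : O F p n m t) :
    projEven (dEven i f) = dEven i (projEven f) := by
  induction f using O.induction with
  | h0 => simp
  | hadd f f' hf hf' => simp only [map_add, hf, hf']
  | hsmul c f hf => simp only [map_smul, hf]
  | hbas a =>
    rw [← mon_expo a, projEven_mon, apply_ite (dEven i), dEven_mon (expo_lt a i),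
      apply_ite projEven, projEven_mon]
    split_ifs <;> simp

theorem projEven_dOdd (j : Fin m) (f : O F p n m t) :
    projEven (dOdd j f) = dOdd j (f - projEven f) := by
  induction f using O.induction with
  | h0 => simp
  | hadd f f' hf hf' => simp only [map_add, hf, hf', map_sub]; abel
  | hsmul c f hf => simp only [map_smul, hf, map_sub, smul_sub]
  | hbas a =>
    rw [← mon_expo a, projEven_mon, map_sub, apply_ite (dOdd j), dOdd_mon,
      apply_ite projEven, map_smul, projEven_mon, map_zero, map_zero]
    by_cases hj : j ∈ a.2
    · have : Even (a.2.erase j).card ↔ ¬ Even a.2.card := by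
        rw [← Finset.card_erase_add_one hj, Nat.even_add_one, not_not]
      simp only [hj, if_true, this]
      split_ifs <;> simp_all
    · simp [hj]

theorem projEven_mul (f g : O F p n m t) :
    projEven (f * g) = projEven f * projEven g + (f - projEven f) * (g - projEven g) := by
  induction f using O.induction with
  | h0 => simp
  | hadd f f' hf hf' => simp only [map_add, add_mul, sub_mul, hf, hf']; abel
  | hsmul c f hf => simp only [map_smul, smul_mul_assoc, hf, smul_add, ← smul_sub]
  | hbas a =>
    induction g using O.induction with
    | h0 => simp
    | hadd f f' hf hf' => simp only [map_add, mul_add, mul_sub, hf, hf']; abel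
    | hsmul c f hf => simp only [map_smul, mul_smul_comm, hf, smul_add, ← smul_sub]
    | hbas b =>
      rw [← mon_expo a, ← mon_expo b, projEven_mon, projEven_mon]
      have key : projEven (mon (expo a) a.2 * mon (expo b) b.2 : O F p n m t) =
          if Even (a.2.card + b.2.card) then mon (expo a) a.2 * mon (expo b) b.2 else 0 := by
        rw [mon_mul_mon]
        split_ifs with h h' h'
        · rw [map_smul, projEven_mon, Finset.card_union_of_disjoint h, if_pos h']
        · rw [map_smul, projEven_mon, Finset.card_union_of_disjoint h, if_neg h', smul_zero]
        · simp
        · simp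
      rw [key]
      simp only [Nat.even_add]
      by_cases ha : Even a.2.card <;> by_cases hb : Even b.2.card <;> simp [ha, hb]

/-- The even elements of `𝒪(n, m; t)`. -/
def IsEven (f : O F p n m t) : Prop := projEven f = f

/-- The odd elements of `𝒪(n, m; t)`. -/
def IsOdd (f : O F p n m t) : Prop := projEven f = 0

theorem isEven_projEven (f : O F p n m t) : IsEven (projEven f) := projEven_projEven f

theorem isOdd_sub_projEven (f : O F p n m t) : IsOdd (f - projEven f) := by
  rw [IsOdd, map_sub, projEven_projEven, sub_self]

theorem IsEven.parity {f : O F p n m t} (h : IsEven f) : OddCartan.parity f = f := by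
  rw [parity_eq, h, sub_self, sub_zero]

theorem IsOdd.parity {f : O F p n m t} (h : IsOdd f) : OddCartan.parity f = -f := by
  rw [parity_eq, h, sub_zero, zero_sub]

theorem projEven_mul_comm (f g : O F p n m t) : g * projEven f = projEven f * g := by
  induction f using O.induction with
  | h0 => simp
  | hadd f f' hf hf' => simp only [map_add, add_mul, mul_add, hf, hf']
  | hsmul c f hf => simp only [map_smul, smul_mul_assoc, mul_smul_comm, hf]
  | hbas a =>
    induction g using O.induction with
    | h0 => simp
    | hadd f f' hf hf' => simp only [mul_add, add_mul, hf, hf']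
    | hsmul c f hf => simp only [smul_mul_assoc, mul_smul_comm, hf]
    | hbas b =>
      rw [projEven_bas]
      split_ifs with h
      · rw [bas_mul_bas_comm, (h.mul_right _).neg_one_pow, one_smul]
      · simp

theorem projOdd_mul_comm (f g : O F p n m t) :
    (g - projEven g) * (f - projEven f) = -((f - projEven f) * (g - projEven g)) := by
  induction f using O.induction with
  | h0 => simp
  | hadd f f' hf hf' =>
    simp only [map_add, add_sub_add_comm, add_mul, mul_add, hf, hf', neg_add]
  | hsmul c f hf =>
    simp only [map_smul, ← smul_sub, smul_mul_assoc, mul_smul_comm, hf, smul_neg]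
  | hbas a =>
    induction g using O.induction with
    | h0 => simp
    | hadd f f' hf hf' =>
      simp only [map_add, add_sub_add_comm, add_mul, mul_add, hf, hf', neg_add]
    | hsmul c f hf =>
      simp only [map_smul, ← smul_sub, smul_mul_assoc, mul_smul_comm, hf, smul_neg]
    | hbas b =>
      rw [projEven_bas, projEven_bas]
      split_ifs with hb ha ha
      · simp
      · simp
      · simp
      · rw [sub_zero, sub_zero, bas_mul_bas_comm,
          ((Nat.not_even_iff_odd.1 ha).mul (Nat.not_even_iff_odd.1 hb)).neg_one_pow, neg_smul,
          one_smul]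

theorem IsEven.mul_comm {f : O F p n m t} (h : IsEven f) (g : O F p n m t) : g * f = f * g := by
  rw [← h, projEven_mul_comm]

theorem IsOdd.mul_comm {f g : O F p n m t} (hf : IsOdd f) (hg : IsOdd g) :
    g * f = -(f * g) := by
  have := projOdd_mul_comm f g
  rwa [hf, hg, sub_zero, sub_zero] at this

/-- Moving an odd factor across g costs exactly the parity automorphism. This makes an odd multiple
of an odd derivation satisfy the unsigned Leibniz rule. -/
theorem IsOdd.mul_parity {f : O F p n m t} (hf : IsOdd f) (g : O F p n m t) :
    f * OddCartan.parity g = g * f := by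
  have h := hf.mul_comm (isOdd_sub_projEven g)
  rw [parity_eq, mul_sub, sub_eq_add_neg, ← h, projEven_mul_comm, ← add_mul,
    add_sub_cancel]

theorem IsEven.mul {f g : O F p n m t} (hf : IsEven f) (hg : IsEven g) : IsEven (f * g) := by
  rw [IsEven, projEven_mul, hf, hg, sub_self, zero_mul, add_zero]

theorem IsOdd.mul {f g : O F p n m t} (hf : IsOdd f) (hg : IsOdd g) : IsEven (f * g) := by
  rw [IsEven, projEven_mul, hf, hg, sub_zero, sub_zero, zero_mul, zero_add]

theorem IsEven.mul_odd {f g : O F p n m t} (hf : IsEven f) (hg : IsOdd g) : IsOdd (f * g) := by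
  rw [IsOdd, projEven_mul, hf, hg, sub_self, zero_mul, mul_zero, add_zero]

theorem IsOdd.mul_even {f g : O F p n m t} (hf : IsOdd f) (hg : IsEven g) : IsOdd (f * g) := by
  rw [IsOdd, projEven_mul, hf, hg, sub_self, zero_mul, mul_zero, add_zero]

variable (F p n m t) in
/-- The even elements of `𝒪(n, m; t)`, as a subspace. -/
noncomputable def evenPart : Submodule F (O F p n m t) := LinearMap.ker (projEven - 1)

variable (F p n m t) in
/-- The odd elements of `𝒪(n, m; t)`, as a subspace. -/
noncomputable def oddElems : Submodule F (O F p n m t) := LinearMap.ker projEven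

theorem mem_evenPart {f : O F p n m t} : f ∈ evenPart F p n m t ↔ IsEven f := by
  simp [evenPart, IsEven, sub_eq_zero]

theorem mem_oddElems {f : O F p n m t} : f ∈ oddElems F p n m t ↔ IsOdd f := by
  simp [oddElems, IsOdd]

theorem isEvenDer_iff {X : Module.End F (O F p n m t)} (h : ∀ f, projEven (X f) = X (projEven f))
    (h' : ∀ f g, X (f * g) = X f * g + f * X g) : IsEvenDer IsEven IsOdd X.toAddMonoidHom where
  map_even f hf := (h f).trans (congrArg X hf)
  map_odd f hf := (h f).trans ((congrArg X hf).trans (map_zero X))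
  leibniz := h'

theorem isOddDer_iff {Y : Module.End F (O F p n m t)}
    (h : ∀ f, projEven (Y f) = Y (f - projEven f))
    (h' : ∀ f g, Y (f * g) = Y f * g + parity f * Y g) :
    IsOddDer IsEven IsOdd Y.toAddMonoidHom where
  map_even f hf := (h f).trans (by rw [hf, sub_self, map_zero])
  map_odd f hf := (h f).trans (by rw [hf, sub_zero]; rfl)
  leibniz_even f g hf := (h' f g).trans (by rw [hf.parity]; rfl)
  leibniz_odd f g hf := (h' f g).trans (by rw [hf.parity, neg_mul, sub_eq_add_neg]; rfl)

/-- An endomorphism that preserves parity. -/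
def IsEvenOp (A : Module.End F (O F p n m t)) : Prop :=
  (∀ f, IsEven f → IsEven (A f)) ∧ ∀ f, IsOdd f → IsOdd (A f)

/-- An endomorphism that reverses parity. -/
def IsOddOp (A : Module.End F (O F p n m t)) : Prop :=
  (∀ f, IsEven f → IsOdd (A f)) ∧ ∀ f, IsOdd f → IsEven (A f)

/-- Together with its odd counterpart, this turns `sbr` into a commutator or anticommutator on
homogeneous operators. -/
theorem IsEvenOp.oddPart {A : Module.End F (O F p n m t)} (h : IsEvenOp A) :
    oddPart A = 0 := by
  ext1 f
  have h1 : projEven (A (f - projEven f)) = 0 := h.2 _ (isOdd_sub_projEven f)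
  have h2 : projEven (A (projEven f)) = A (projEven f) := h.1 _ (isEven_projEven f)
  simp [OddCartan.oddPart, projOdd, h2]
  simpa [sub_eq_zero, h2] using h1

theorem IsOddOp.oddPart {A : Module.End F (O F p n m t)} (h : IsOddOp A) :
    oddPart A = A := by
  ext1 f
  have h1 : projEven (A (f - projEven f)) = A (f - projEven f) := h.2 _ (isOdd_sub_projEven f)
  have h2 : projEven (A (projEven f)) = 0 := h.1 _ (isEven_projEven f)
  simp [OddCartan.oddPart, projOdd, h2]
  simpa [h2, eq_sub_iff_add_eq] using h1

theorem sbr_of_isEvenOp_left {A : Module.End F (O F p n m t)} (h : IsEvenOp A)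
    (B : Module.End F (O F p n m t)) : sbr A B = A * B - B * A := by
  rw [sbr, h.oddPart, mul_zero, smul_zero, add_zero]

theorem sbr_of_isEvenOp_right {B : Module.End F (O F p n m t)} (h : IsEvenOp B)
    (A : Module.End F (O F p n m t)) : sbr A B = A * B - B * A := by
  rw [sbr, h.oddPart, zero_mul, smul_zero, add_zero]

theorem sbr_of_isOddOp {A B : Module.End F (O F p n m t)} (hA : IsOddOp A) (hB : IsOddOp B) :
    sbr A B = A * B + B * A := by
  rw [sbr, hA.oddPart, hB.oddPart, two_smul]
  abel

theorem sbr_add_left (A A' B : Module.End F (O F p n m t)) :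
    sbr (A + A') B = sbr A B + sbr A' B := by
  simp only [sbr, oddPart, mul_add, add_mul, smul_add]
  abel

theorem sbr_add_right (A B B' : Module.End F (O F p n m t)) :
    sbr A (B + B') = sbr A B + sbr A B' := by
  simp only [sbr, oddPart, mul_add, add_mul, smul_add]
  abel

/-! ### Closure under the supercommutator for operators given by a contact frame. -/

section Frame

variable {ι : Type*} [Fintype ι] {X Y : ι → O F p n m t →+ O F p n m t}
  {Z : O F p n m t →+ O F p n m t}

/-- A linear family of operators that on homogeneous elements is given by a contact frame. -/
structure IsContactMap (X Y : ι → O F p n m t →+ O F p n m t) (Z : O F p n m t →+ O F p n m t)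
    (T : O F p n m t →ₗ[F] Module.End F (O F p n m t)) : Prop where
  frame : IsContactFrame IsEven IsOdd X Y Z
  apply_even : ∀ f w, IsEven f → T f w = contactOp X Y Z 1 f w
  apply_odd : ∀ f w, IsOdd f → T f w = contactOp X Y Z (-1) f w

variable {T : O F p n m t →ₗ[F] Module.End F (O F p n m t)}

theorem contactOp_mem {S : Submodule F (O F p n m t)} {s : ℤ} {f w : O F p n m t}
    (h : ∀ i, X i f * Y i w ∈ S ∧ Y i f * X i w ∈ S) (hZ : f * Z w ∈ S) :
    contactOp X Y Z s f w ∈ S := by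
  refine S.sub_mem (S.sum_mem fun i _ => S.add_mem (h i).1 ?_) ?_
  · exact S.toAddSubgroup.zsmul_mem (h i).2 s
  · exact S.toAddSubgroup.zsmul_mem hZ 2

/-- Each summand of T(f)(w) involves exactly one odd derivation, so T reverses parity. -/
theorem IsContactMap.isOddOp (H : IsContactMap X Y Z T) {f : O F p n m t} (hf : IsEven f) :
    IsOddOp (T f) := by
  refine ⟨fun w hw => ?_, fun w hw => ?_⟩
  · rw [H.apply_even f w hf, ← mem_oddElems]
    refine contactOp_mem (fun i => ⟨mem_oddElems.2 ?_, mem_oddElems.2 ?_⟩) (mem_oddElems.2 ?_)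
    · exact ((H.frame.even i).map_even f hf).mul_odd ((H.frame.odd i).map_even w hw)
    · exact ((H.frame.odd i).map_even f hf).mul_even ((H.frame.even i).map_even w hw)
    · exact hf.mul_odd (H.frame.reeb.map_even w hw)
  · rw [H.apply_even f w hf, ← mem_evenPart]
    refine contactOp_mem (fun i => ⟨mem_evenPart.2 ?_, mem_evenPart.2 ?_⟩) (mem_evenPart.2 ?_)
    · exact ((H.frame.even i).map_even f hf).mul ((H.frame.odd i).map_odd w hw)
    · exact ((H.frame.odd i).map_even f hf).mul ((H.frame.even i).map_odd w hw)
    · exact hf.mul (H.frame.reeb.map_odd w hw)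

theorem IsContactMap.isEvenOp (H : IsContactMap X Y Z T) {f : O F p n m t} (hf : IsOdd f) :
    IsEvenOp (T f) := by
  refine ⟨fun w hw => ?_, fun w hw => ?_⟩
  · rw [H.apply_odd f w hf, ← mem_evenPart]
    refine contactOp_mem (fun i => ⟨mem_evenPart.2 ?_, mem_evenPart.2 ?_⟩) (mem_evenPart.2 ?_)
    · exact ((H.frame.even i).map_odd f hf).mul ((H.frame.odd i).map_even w hw)
    · exact ((H.frame.odd i).map_odd f hf).mul ((H.frame.even i).map_even w hw)
    · exact hf.mul (H.frame.reeb.map_even w hw)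
  · rw [H.apply_odd f w hf, ← mem_oddElems]
    refine contactOp_mem (fun i => ⟨mem_oddElems.2 ?_, mem_oddElems.2 ?_⟩) (mem_oddElems.2 ?_)
    · exact ((H.frame.even i).map_odd f hf).mul_even ((H.frame.odd i).map_odd w hw)
    · exact ((H.frame.odd i).map_odd f hf).mul_odd ((H.frame.even i).map_odd w hw)
    · exact hf.mul_even (H.frame.reeb.map_odd w hw)

theorem IsContactMap.sbr_eq (H : IsContactMap X Y Z T) {a b : O F p n m t}
    (ha : IsEven a ∨ IsOdd a) (hb : IsEven b ∨ IsOdd b) :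
    sbr (T a) (T b) = T (T a b - (2 : ℤ) • (Z (parity a) * b)) := by
  rcases ha with ha | ha <;> rcases hb with hb | hb
  · have hc : IsOdd (T a b - (2 : ℤ) • (Z (parity a) * b)) := by
      rw [ha.parity, ← mem_oddElems]
      exact Submodule.sub_mem _ (mem_oddElems.2 ((H.isOddOp ha).1 b hb))
        (zsmul_mem (mem_oddElems.2
          ((H.frame.reeb.map_even a ha).mul_even hb)) 2)
    rw [sbr_of_isOddOp (H.isOddOp ha) (H.isOddOp hb)]
    ext1 w
    have := H.frame.bracket (Or.inl ⟨ha, rfl, hb, rfl, rfl⟩) w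
    rw [neg_one_smul, sub_neg_eq_add] at this
    rw [H.apply_odd _ _ hc, ha.parity, H.apply_even a b ha]
    simpa [H.apply_even _ _ ha, H.apply_even _ _ hb] using this
  · have hc : IsEven (T a b - (2 : ℤ) • (Z (parity a) * b)) := by
      rw [ha.parity, ← mem_evenPart]
      exact Submodule.sub_mem _ (mem_evenPart.2 ((H.isOddOp ha).2 b hb))
        (zsmul_mem (mem_evenPart.2
          ((H.frame.reeb.map_even a ha).mul hb)) 2)
    rw [sbr_of_isEvenOp_right (H.isEvenOp hb)]
    ext1 w
    have := H.frame.bracket (Or.inr (Or.inl ⟨ha, rfl, hb, rfl, rfl⟩)) w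
    rw [H.apply_even _ _ hc, ha.parity, H.apply_even a b ha]
    simpa [H.apply_even _ _ ha, H.apply_odd _ _ hb] using this
  · have hc : IsEven (T a b - (2 : ℤ) • (Z (parity a) * b)) := by
      rw [ha.parity, map_neg, neg_mul, ← mem_evenPart]
      exact Submodule.sub_mem _ (mem_evenPart.2 ((H.isEvenOp ha).1 b hb))
        (zsmul_mem (neg_mem (mem_evenPart.2
          ((H.frame.reeb.map_odd a ha).mul hb))) 2)
    rw [sbr_of_isEvenOp_left (H.isEvenOp ha)]
    ext1 w
    have := H.frame.bracket (Or.inr (Or.inr (Or.inl ⟨ha, rfl, hb, rfl, rfl⟩))) w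
    rw [H.apply_even _ _ hc, ha.parity, H.apply_odd a b ha]
    simpa [H.apply_odd _ _ ha, H.apply_even _ _ hb] using this
  · have hc : IsOdd (T a b - (2 : ℤ) • (Z (parity a) * b)) := by
      rw [ha.parity, map_neg, neg_mul, ← mem_oddElems]
      exact Submodule.sub_mem _ (mem_oddElems.2 ((H.isEvenOp ha).2 b hb))
        (zsmul_mem (neg_mem (mem_oddElems.2
          ((H.frame.reeb.map_odd a ha).mul_odd hb))) 2)
    rw [sbr_of_isEvenOp_left (H.isEvenOp ha)]
    ext1 w
    have := H.frame.bracket (Or.inr (Or.inr (Or.inr ⟨ha, rfl, hb, rfl, rfl⟩))) w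
    rw [H.apply_odd _ _ hc, ha.parity, H.apply_odd a b ha]
    simpa [H.apply_odd _ _ ha, H.apply_odd _ _ hb] using this

/-- The bracket of two contact operators. -/
theorem IsContactMap.sbr (H : IsContactMap X Y Z T) (a b : O F p n m t) :
    sbr (T a) (T b) = T (T a b - (2 : ℤ) • (Z (parity a) * b)) := by
  have ha : a = projEven a + (a - projEven a) := by abel
  have hb : b = projEven b + (b - projEven b) := by abel
  have ha0 := isEven_projEven a
  have ha1 := isOdd_sub_projEven a
  have hb0 := isEven_projEven b
  have hb1 := isOdd_sub_projEven b
  rw [ha, hb]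
  generalize projEven a = a0 at *
  generalize projEven b = b0 at *
  generalize a - a0 = a1 at *
  generalize b - b0 = b1 at *
  simp only [map_add, sbr_add_left, sbr_add_right, H.sbr_eq (.inl ha0) (.inl hb0),
    H.sbr_eq (.inl ha0) (.inr hb1), H.sbr_eq (.inr ha1) (.inl hb0),
    H.sbr_eq (.inr ha1) (.inr hb1), map_sub, LinearMap.add_apply, add_mul, mul_add, smul_add]
  abel

theorem IsContactMap.isClosedSbr (H : IsContactMap X Y Z T) :
    IsClosedSbr (LinearMap.range T) := by
  rintro _ ⟨a, rfl⟩ _ ⟨b, rfl⟩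
  exact ⟨_, (H.sbr a b).symm⟩

end Frame

end Parity

/-! ### The frames of HO and KO. -/

section Frames

variable {F : Type*} [Field F] {p n m : ℕ} {t : Fin n → ℕ}

theorem last_ne_castSucc (i : Fin n) : Fin.last n ≠ i.castSucc := (Fin.castSucc_lt_last i).ne'

theorem dEven_xEven (h : ∀ i, 1 < p ^ t i) (i j : Fin n) :
    dEven i (xEven j : O F p n m t) = if i = j then mon 0 ∅ else 0 := by
  rw [xEven, dEven_mon]
  · by_cases hij : i = j
    · subst hij; simp
    · simp [hij]
  · by_cases hij : i = j
    · subst hij; simpa using h i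
    · rw [Pi.single_eq_of_ne hij]
      exact zero_lt_one.trans (h i)

theorem dOdd_xEven (i : Fin n) (j : Fin m) : dOdd j (xEven i : O F p n m t) = 0 := by
  simp [xEven, dOdd_mon]

theorem dEven_mon_zero (h : ∀ i, 1 < p ^ t i) (i : Fin n) (u : Finset (Fin m)) :
    dEven i (mon 0 u : O F p n m t) = 0 := by
  rw [dEven_mon (zero_lt_one.trans (h i)), Pi.zero_apply, if_pos rfl]

theorem dEven_xOdd (h : ∀ i, 1 < p ^ t i) (i : Fin n) (j : Fin m) :
    dEven i (xOdd j : O F p n m t) = 0 := dEven_mon_zero h i _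

theorem dOdd_xOdd (j k : Fin m) :
    dOdd j (xOdd k : O F p n m t) = if j = k then mon 0 ∅ else 0 := by
  rw [xOdd, dOdd_mon]
  by_cases hjk : j = k
  · subst hjk; simp [Finset.filter_singleton]
  · simp [hjk]

theorem dOdd_mon_zero (j : Fin m) : dOdd j (mon 0 ∅ : O F p n m t) = 0 := by
  simp [dOdd_mon]

theorem isEven_xEven (i : Fin n) : IsEven (xEven i : O F p n m t) := by
  simp [IsEven, xEven, projEven_mon]

theorem isOdd_xOdd (j : Fin m) : IsOdd (xOdd j : O F p n m t) := by
  simp [IsOdd, xOdd, projEven_mon]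

theorem isEven_mon_zero : IsEven (mon 0 ∅ : O F p n m t) := by
  simp [IsEven, projEven_mon]

theorem TH_apply (e : Fin n → Fin m) (f w : O F p n m t) :
    TH e f w = ∑ i, (dEven i f * dOdd (e i) w + dOdd (e i) (parity f) * dEven i w) := by
  induction f using O.induction with
  | h0 => simp
  | hadd f f' hf hf' =>
    simp only [map_add, LinearMap.add_apply, hf, hf', add_mul, ← Finset.sum_add_distrib]
    exact Finset.sum_congr rfl fun i _ => by abel
  | hsmul c f hf =>
    simp only [map_smul, LinearMap.smul_apply, hf, smul_mul_assoc, Finset.smul_sum, smul_add]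
  | hbas a =>
    simp only [TH, Module.Basis.constr_basis, LinearMap.sum_apply, LinearMap.add_apply,
      LinearMap.smul_apply, Module.End.mul_apply, mul_apply, parity_bas, map_smul, smul_mul_assoc]

theorem TK_apply (f w : O F p n (n + 1) t) :
    TK f w = TH Fin.castSucc f w + dOdd (Fin.last n) (parity f) * euler w +
      (euler f - (2 : F) • f) * dOdd (Fin.last n) w := by
  induction f using O.induction with
  | h0 => simp
  | hadd f f' hf hf' =>
    simp only [map_add, LinearMap.add_apply, hf, hf', add_mul, smul_add, add_sub_add_comm]
    abel
  | hsmul c f hf =>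
    simp only [map_smul, LinearMap.smul_apply, hf, smul_mul_assoc, smul_add, ← smul_sub,
      smul_comm (2 : F) c]
  | hbas a =>
    simp only [TK, Module.Basis.constr_basis, LinearMap.add_apply,
      LinearMap.smul_apply, Module.End.mul_apply, mul_apply, parity_bas, map_smul, smul_mul_assoc]

theorem euler_apply (f : O F p n (n + 1) t) :
    euler f = ∑ i : Fin n, (xEven i * dEven i f + xOdd i.castSucc * dOdd i.castSucc f) := by
  simp only [euler, LinearMap.sum_apply, LinearMap.add_apply, Module.End.mul_apply, mul_apply]

theorem isEvenDer_dEven [CharP F p] (hp : p.Prime) (i : Fin n) :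
    IsEvenDer IsEven IsOdd (dEven i : Module.End F (O F p n m t)).toAddMonoidHom :=
  isEvenDer_iff (projEven_dEven i) (dEven_mul hp i)

theorem isOddDer_dOdd (j : Fin m) :
    IsOddDer IsEven IsOdd (dOdd j : Module.End F (O F p n m t)).toAddMonoidHom :=
  isOddDer_iff (projEven_dOdd j) (dOdd_mul j)

theorem isOddDer_zero :
    IsOddDer IsEven IsOdd (0 : O F p n m t →+ O F p n m t) where
  map_even f _ := map_zero projEven
  map_odd f _ := map_zero projEven
  leibniz_even f g _ := by simp
  leibniz_odd f g _ := by simp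

/-- The partial derivatives themselves form a frame with Z = 0. -/
theorem isContactMap_TH [CharP F p] (hp : p.Prime) (e : Fin n → Fin m) :
    IsContactMap (fun i => (dEven i : Module.End F (O F p n m t)).toAddMonoidHom)
      (fun i => (dOdd (e i) : Module.End F (O F p n m t)).toAddMonoidHom) 0 (TH e) where
  frame :=
    { even := isEvenDer_dEven hp
      odd := fun i => isOddDer_dOdd (e i)
      reeb := isOddDer_zero
      X_X := dEven_comm
      Y_X := fun i j f _ => (dEven_dOdd j (e i) f).symm
      Y_X_self := fun i f => by simpa using (dEven_dOdd i (e i) f).symm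
      Y_Y := fun i j => dOdd_anticomm (e i) (e j)
      Y_Y_self := fun i => dOdd_dOdd_self (e i)
      Z_X := by simp
      Z_Y := by simp
      Z_Z := by simp
      even_even := fun f g hf _ => hf.mul_comm g
      even_odd := fun f g hf _ => hf.mul_comm g
      odd_odd := fun f g hf hg => hf.mul_comm hg }
  apply_even f w hf := by
    simp [TH_apply, contactOp, pairOp, hf.parity]
  apply_odd f w hf := by
    simp [TH_apply, contactOp, pairOp, hf.parity]

/-- The even members of the contact frame of `𝒪(n, n + 1; t)`. -/
noncomputable def contactX (i : Fin n) : Module.End F (O F p n (n + 1) t) :=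
  dEven i - mul (xOdd i.castSucc) * dOdd (Fin.last n)

/-- The odd members of the contact frame of `𝒪(n, n + 1; t)`. -/
noncomputable def contactY (i : Fin n) : Module.End F (O F p n (n + 1) t) :=
  dOdd i.castSucc + mul (xEven i) * dOdd (Fin.last n)

theorem contactX_apply (i : Fin n) (f : O F p n (n + 1) t) :
    contactX i f = dEven i f - xOdd i.castSucc * dOdd (Fin.last n) f := rfl

theorem contactY_apply (i : Fin n) (f : O F p n (n + 1) t) :
    contactY i f = dOdd i.castSucc f + xEven i * dOdd (Fin.last n) f := rfl

theorem isEvenDer_contactX [CharP F p] (hp : p.Prime) (i : Fin n) :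
    IsEvenDer IsEven IsOdd (contactX i : Module.End F (O F p n (n + 1) t)).toAddMonoidHom := by
  refine isEvenDer_iff (fun f => ?_) fun f g => ?_
  · have hy := isOdd_xOdd (F := F) (p := p) (t := t) i.castSucc
    simp only [contactX_apply, map_sub, projEven_dEven, projEven_mul, projEven_dOdd]
    rw [show projEven (xOdd i.castSucc : O F p n (n + 1) t) = 0 from hy]
    simp
  · simp only [contactX_apply, dEven_mul hp, dOdd_mul, mul_add, sub_mul, mul_sub, ← mul_assoc,
      (isOdd_xOdd i.castSucc).mul_parity]
    abel

theorem isOddDer_contactY (i : Fin n) :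
    IsOddDer IsEven IsOdd (contactY i : Module.End F (O F p n (n + 1) t)).toAddMonoidHom := by
  refine isOddDer_iff (fun f => ?_) fun f g => ?_
  · have hx := isEven_xEven (F := F) (p := p) (m := n + 1) (t := t) i
    simp only [contactY_apply, map_add, projEven_mul, projEven_dOdd]
    rw [show projEven (xEven i : O F p n (n + 1) t) = xEven i from hx]
    simp
  · simp only [contactY_apply, dOdd_mul, mul_add, add_mul, ← mul_assoc,
      (isEven_xEven i).mul_comm (parity f)]
    abel

theorem TK_apply_sum (f w : O F p n (n + 1) t) :
    TK f w = ∑ i : Fin n, (dEven i f * dOdd i.castSucc w +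
        dOdd i.castSucc (parity f) * dEven i w +
        dOdd (Fin.last n) (parity f) * (xEven i * dEven i w + xOdd i.castSucc * dOdd i.castSucc w) +
        (xEven i * dEven i f + xOdd i.castSucc * dOdd i.castSucc f) * dOdd (Fin.last n) w) -
      (2 : ℤ) • (f * dOdd (Fin.last n) w) := by
  rw [TK_apply, TH_apply, euler_apply, euler_apply, sub_mul, Finset.sum_mul, Finset.mul_sum,
    smul_mul_assoc, ← add_sub_assoc, ← Finset.sum_add_distrib, ← Finset.sum_add_distrib, two_smul,
    two_smul]

/-- The corrections by x_{i'} ∂_{2n+1} and x_i ∂_{2n+1} absorb the terms of `TK` with 𝔇: in the i-th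
summand the mixed terms are those of 𝔇, and the two terms with both Z(f) and Z(w) cancel. The
condition 1 < p^{t_i} makes ∂_i(x_i) = 1, from which, with ∂_{i'}(x_{i'}) = 1, comes [Y_i, X_i] =
-2Z. -/
theorem isContactMap_TK [CharP F p] (hp : p.Prime) (h : ∀ i, 1 < p ^ t i) :
    IsContactMap (fun i => (contactX i : Module.End F (O F p n (n + 1) t)).toAddMonoidHom)
      (fun i => (contactY i : Module.End F (O F p n (n + 1) t)).toAddMonoidHom)
      (dOdd (Fin.last n) : Module.End F (O F p n (n + 1) t)).toAddMonoidHom TK where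
  frame :=
    { even := isEvenDer_contactX hp
      odd := isOddDer_contactY
      reeb := isOddDer_dOdd _
      X_X := fun i j f => by
        simp [contactX_apply, dEven_mul hp, dOdd_mul, dEven_xOdd h, dOdd_xOdd, dEven_dOdd,
          dOdd_dOdd_self, (isOdd_xOdd _).parity, last_ne_castSucc, dEven_comm i j]
        abel
      Y_X := fun i j f hij => by
        simp [contactX_apply, contactY_apply, dEven_mul hp, dOdd_mul, dOdd_xOdd,
          dEven_dOdd, dOdd_dOdd_self, (isOdd_xOdd _).parity, hij, hij.symm,
          dEven_xEven h, dOdd_xEven, (isEven_xEven _).parity, last_ne_castSucc,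
          dOdd_anticomm (Fin.last n) i.castSucc]
        abel
      Y_X_self := fun i f => by
        simp [contactX_apply, contactY_apply, dEven_mul hp, dOdd_mul, dOdd_xOdd,
          dEven_dOdd, dOdd_dOdd_self, (isOdd_xOdd _).parity,
          dEven_xEven h, dOdd_xEven, (isEven_xEven _).parity, last_ne_castSucc,
          dOdd_anticomm (Fin.last n) i.castSucc, mon_zero_mul, two_smul]
        abel
      Y_Y := fun i j f => by
        simp [contactY_apply, dOdd_mul, dOdd_dOdd_self, dOdd_xEven,
          (isEven_xEven _).parity, dOdd_anticomm (Fin.last n) i.castSucc,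
          dOdd_anticomm (Fin.last n) j.castSucc, dOdd_anticomm i.castSucc j.castSucc]
        abel
      Y_Y_self := fun i f => by
        simp [contactY_apply, dOdd_mul, dOdd_dOdd_self, dOdd_xEven,
          (isEven_xEven _).parity, dOdd_anticomm (Fin.last n) i.castSucc]
      Z_X := fun i f => by
        simp [contactX_apply, dOdd_mul, dOdd_xOdd, dEven_dOdd, dOdd_dOdd_self,
          last_ne_castSucc]
      Z_Y := fun i f => by
        simp [contactY_apply, dOdd_mul, dOdd_xEven, dOdd_dOdd_self,
          dOdd_anticomm (Fin.last n) i.castSucc]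
      Z_Z := dOdd_dOdd_self _
      even_even := fun f g hf _ => hf.mul_comm g
      even_odd := fun f g hf _ => hf.mul_comm g
      odd_odd := fun f g hf hg => hf.mul_comm hg }
  apply_even f w hf := by
    rw [TK_apply_sum, hf.parity, contactOp]
    congr 1
    refine Finset.sum_congr rfl fun i _ => ?_
    have hz : IsOdd (dOdd (Fin.last n) f) := (isOddDer_dOdd _).map_even f hf
    have hd : IsOdd (dOdd i.castSucc f) := (isOddDer_dOdd _).map_even f hf
    have hy := isOdd_xOdd (F := F) (p := p) (t := t) i.castSucc
    have hx := isEven_xEven (F := F) (p := p) (m := n + 1) (t := t) i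
    have c (g : O F p n (n + 1) t) : g * (xEven i) = xEven i * g := hx.mul_comm g
    have c' (g g' : O F p n (n + 1) t) : g * ((xEven i) * g') = xEven i * (g * g') := by
      rw [← mul_assoc, c, mul_assoc]
    have d (w : O F p n (n + 1) t) : dOdd (Fin.last n) f * (xOdd i.castSucc * w) =
        -(xOdd i.castSucc * (dOdd (Fin.last n) f * w)) := by
      rw [← mul_assoc, hy.mul_comm hz, neg_mul, mul_assoc]
    have d' (w : O F p n (n + 1) t) : dOdd i.castSucc f * (xOdd i.castSucc * w) =
        -(xOdd i.castSucc * (dOdd i.castSucc f * w)) := by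
      rw [← mul_assoc, hy.mul_comm hd, neg_mul, mul_assoc]
    simp [pairOp, contactX_apply, contactY_apply, mul_add, add_mul, mul_sub, sub_mul, mul_assoc,
      c', d, d']
    abel
  apply_odd f w hf := by
    rw [TK_apply_sum, hf.parity, contactOp]
    congr 1
    refine Finset.sum_congr rfl fun i _ => ?_
    have hz : IsEven (dOdd (Fin.last n) f) := (isOddDer_dOdd _).map_odd f hf
    have hd : IsEven (dOdd i.castSucc f) := (isOddDer_dOdd _).map_odd f hf
    have hx := isEven_xEven (F := F) (p := p) (m := n + 1) (t := t) i
    have c (g : O F p n (n + 1) t) : g * (xEven i) = xEven i * g := hx.mul_comm g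
    have c' (g g' : O F p n (n + 1) t) : g * ((xEven i) * g') = xEven i * (g * g') := by
      rw [← mul_assoc, c, mul_assoc]
    have d (w : O F p n (n + 1) t) : dOdd (Fin.last n) f * (xOdd i.castSucc * w) =
        xOdd i.castSucc * (dOdd (Fin.last n) f * w) := by
      rw [← mul_assoc, ← hz.mul_comm, mul_assoc]
    have d' (w : O F p n (n + 1) t) : dOdd i.castSucc f * (xOdd i.castSucc * w) =
        xOdd i.castSucc * (dOdd i.castSucc f * w) := by
      rw [← mul_assoc, ← hd.mul_comm, mul_assoc]
    simp [pairOp, contactX_apply, contactY_apply, mul_add, add_mul, mul_sub, sub_mul, mul_assoc,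
      c', d, d']
    abel

end Frames

/-! ### Absence of nondegenerate associative forms. -/

section Forms

variable {F : Type*} [Field F] {p n m : ℕ} {t : Fin n → ℕ}

theorem TH_xEven (h : ∀ i, 1 < p ^ t i) (e : Fin n → Fin m) (i : Fin n) (w : O F p n m t) :
    TH e (xEven i) w = dOdd (e i) w := by
  simp [TH_apply, (isEven_xEven i).parity, dEven_xEven h, dOdd_xEven, mon_zero_mul, ite_mul]

theorem TH_xOdd (h : ∀ i, 1 < p ^ t i) {e : Fin n → Fin m} (he : Function.Injective e)
    (i : Fin n) (w : O F p n m t) : TH e (xOdd (e i)) w = -dEven i w := by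
  simp [TH_apply, (isOdd_xOdd _).parity, dEven_xOdd h, dOdd_xOdd, he.eq_iff,
    Finset.sum_neg_distrib, mon_zero_mul, ite_mul]

theorem dEven_xEven_mul_xOdd [CharP F p] (hp : p.Prime) (h : ∀ i, 1 < p ^ t i) (i k : Fin n)
    (j : Fin m) :
    dEven k (xEven i * xOdd j : O F p n m t) = if k = i then xOdd j else 0 := by
  simp [dEven_mul hp, dEven_xEven h, dEven_xOdd h, mon_zero_mul, ite_mul]

theorem dOdd_xEven_mul_xOdd (i : Fin n) (j k : Fin m) :
    dOdd k (xEven i * xOdd j : O F p n m t) = if k = j then xEven i else 0 := by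
  simp [dOdd_mul, dOdd_xEven, dOdd_xOdd, (isEven_xEven i).parity, mul_mon_zero]

theorem isOdd_xEven_mul_xOdd (i : Fin n) (j : Fin m) :
    IsOdd (xEven i * xOdd j : O F p n m t) := (isEven_xEven i).mul_odd (isOdd_xOdd j)

theorem TH_xEven_mul_xOdd [CharP F p] (hp : p.Prime) (h : ∀ i, 1 < p ^ t i) {e : Fin n → Fin m}
    (he : Function.Injective e) (i : Fin n) (w : O F p n m t) :
    TH e (xEven i * xOdd (e i)) w = xOdd (e i) * dOdd (e i) w - xEven i * dEven i w := by
  rw [TH_apply, (isOdd_xEven_mul_xOdd _ _).parity]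
  simp [dEven_xEven_mul_xOdd hp h, dOdd_xEven_mul_xOdd, he.eq_iff, Finset.sum_add_distrib, ite_mul,
    sub_eq_add_neg]

theorem TH_mon_zero (h : ∀ i, 1 < p ^ t i) (e : Fin n → Fin m) :
    TH e (mon 0 ∅ : O F p n m t) = 0 := by
  ext1 w
  simp [TH_apply, isEven_mon_zero.parity, dEven_mon_zero h, dOdd_mon_zero]

theorem euler_xEven (h : ∀ i, 1 < p ^ t i) (i : Fin n) :
    euler (xEven i : O F p n (n + 1) t) = xEven i := by
  simp [euler_apply, dEven_xEven h, dOdd_xEven, mul_mon_zero]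

theorem euler_xOdd (h : ∀ i, 1 < p ^ t i) (i : Fin n) :
    euler (xOdd i.castSucc : O F p n (n + 1) t) = xOdd i.castSucc := by
  simp [euler_apply, dEven_xOdd h, dOdd_xOdd, mul_mon_zero]

theorem euler_xEven_mul_xOdd [CharP F p] (hp : p.Prime) (h : ∀ i, 1 < p ^ t i) (i : Fin n) :
    euler (xEven i * xOdd i.castSucc : O F p n (n + 1) t) =
      (2 : F) • (xEven i * xOdd i.castSucc) := by
  simp [euler_apply, dEven_xEven_mul_xOdd hp h, dOdd_xEven_mul_xOdd, Finset.sum_add_distrib,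
    two_smul, (isEven_xEven i).mul_comm]

theorem euler_mon_zero (h : ∀ i, 1 < p ^ t i) : euler (mon 0 ∅ : O F p n (n + 1) t) = 0 := by
  simp [euler_apply, dEven_mon_zero h, dOdd_mon_zero]

theorem TK_xEven (h : ∀ i, 1 < p ^ t i) (i : Fin n) (w : O F p n (n + 1) t) :
    TK (xEven i) w = dOdd i.castSucc w - xEven i * dOdd (Fin.last n) w := by
  rw [TK_apply, TH_xEven h, (isEven_xEven i).parity, dOdd_xEven, euler_xEven h, two_smul]
  simp [sub_eq_add_neg]

theorem TK_xOdd (h : ∀ i, 1 < p ^ t i) (i : Fin n) (w : O F p n (n + 1) t) :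
    TK (xOdd i.castSucc) w = -dEven i w - xOdd i.castSucc * dOdd (Fin.last n) w := by
  rw [TK_apply, TH_xOdd h (Fin.castSucc_injective n), (isOdd_xOdd _).parity, map_neg, dOdd_xOdd,
    if_neg (last_ne_castSucc i), euler_xOdd h, two_smul]
  simp [sub_eq_add_neg]

theorem TK_xEven_mul_xOdd [CharP F p] (hp : p.Prime) (h : ∀ i, 1 < p ^ t i) (i : Fin n)
    (w : O F p n (n + 1) t) :
    TK (xEven i * xOdd i.castSucc) w =
      xOdd i.castSucc * dOdd i.castSucc w - xEven i * dEven i w := by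
  rw [TK_apply, TH_xEven_mul_xOdd hp h (Fin.castSucc_injective n),
    (isOdd_xEven_mul_xOdd _ _).parity, map_neg, dOdd_xEven_mul_xOdd, if_neg (last_ne_castSucc i),
    euler_xEven_mul_xOdd hp h]
  simp

theorem TK_mon_zero (h : ∀ i, 1 < p ^ t i) :
    TK (mon 0 ∅ : O F p n (n + 1) t) = -(2 : F) • dOdd (Fin.last n) := by
  ext1 w
  rw [TK_apply, TH_mon_zero h, isEven_mon_zero.parity, dOdd_mon_zero, euler_mon_zero h]
  simp [smul_mul_assoc, mon_zero_mul]

theorem xEven_mul_dEven_mon {α : Fin n → ℕ} {i : Fin n} (h : α i < p ^ t i)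
    (u : Finset (Fin m)) :
    xEven i * dEven i (mon α u : O F p n m t) = (α i : F) • mon α u := by
  rw [dEven_mon h, xEven]
  split_ifs with h0
  · simp [h0]
  · have h1 : Pi.single i 1 + (α - Pi.single i 1) = α := by
      ext j
      by_cases hj : j = i
      · subst hj; simp; omega
      · simp [hj]
    rw [mon_mul_mon, if_pos (by simp), h1, Finset.empty_union]
    have h2 : multichoose (Pi.single i 1) (α - Pi.single i 1) = α i := by
      rw [multichoose, Finset.prod_eq_single i]
      · simp only [Pi.single_eq_same, Pi.sub_apply, Nat.choose_one_right]
        omega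
      · intro j _ hj
        simp [hj]
      · simp
    rw [h2]
    simp [inversions]

theorem xOdd_mul_dOdd_mon (α : Fin n → ℕ) (j : Fin m) (u : Finset (Fin m)) :
    xOdd j * dOdd j (mon α u : O F p n m t) = if j ∈ u then mon α u else 0 := by
  rw [dOdd_mon, xOdd]
  split_ifs with hj
  · have h1 : ((u.erase j).filter (· < j)).card = (u.filter (· < j)).card := by
      rw [Finset.filter_erase, Finset.erase_eq_of_notMem (by simp)]
    rw [mul_smul_comm, mon_mul_mon, if_pos (by simp), inversions_singleton_left, h1, zero_add,
      ← Finset.insert_eq, Finset.insert_erase hj, smul_smul, multichoose_comm,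
      multichoose_zero_right, Nat.cast_one, mul_one, neg_one_pow_mul_self, one_smul]
  · exact mul_zero _

/-- Applied to the maximal exponent π_i = p^{t_i} - 1, this makes the top monomial an eigenvector of
x_i ∂_i with eigenvalue -1. -/
theorem natCast_eq_neg_one [CharP F p] {k s : ℕ} (hs : 0 < s) (h : k + 1 = p ^ s) :
    (k : F) = -1 := by
  rw [eq_neg_iff_add_eq_zero, ← Nat.cast_one, ← Nat.cast_add, h, Nat.cast_pow,
    CharP.cast_eq_zero, zero_pow hs.ne']

/-- A basis vector is in the image of `∂_i`, or in the image of `∂_j`, or it is of maximal degree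
in both `x_i` and `x_j`. -/
theorem bas_cases [CharP F p] (ht : ∀ i, 0 < t i) (i : Fin n) (j : Fin m)
    (a : Mono p n m t) :
    (∃ g, dEven i g = (bas a : O F p n m t)) ∨ (∃ g, dOdd j g = (bas a : O F p n m t)) ∨
      (xEven i * dEven i (bas a : O F p n m t) = -bas a ∧
        xOdd j * dOdd j (bas a : O F p n m t) = bas a) := by
  rw [← mon_expo a]
  by_cases hi : expo a i + 1 < p ^ t i
  · left
    refine ⟨mon (expo a + Pi.single i 1) a.2, ?_⟩
    rw [dEven_mon (by simpa using hi), if_neg (by simp), add_tsub_cancel_right]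
  right
  by_cases hj : j ∈ a.2
  · right
    rw [xEven_mul_dEven_mon (expo_lt a i), xOdd_mul_dOdd_mon, if_pos hj]
    refine ⟨?_, rfl⟩
    rw [natCast_eq_neg_one (ht i) (by have := expo_lt a i; omega), neg_one_smul]
  · left
    refine ⟨(-1 : F) ^ (a.2.filter (· < j)).card • mon (expo a) (insert j a.2), ?_⟩
    rw [map_smul, dOdd_mon, if_pos (by simp), card_filter_lt_insert, Finset.erase_insert hj,
      smul_smul, neg_one_pow_mul_self, one_smul]

/-- An associative form on the image of `T` pulls back to a form on `𝒪(n, m; t)`; if all these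
pullbacks have a common vector `u` with `T u ≠ 0` in their left radicals, then no associative form
is nondegenerate. -/
theorem not_exists_isAssociative (T : O F p n m t →ₗ[F] Module.End F (O F p n m t))
    (c : O F p n m t → O F p n m t → O F p n m t) (hT : ∀ a b, sbr (T a) (T b) = T (c a b))
    (hL : IsClosedSbr (LinearMap.range T)) (u : O F p n m t) (hu : T u ≠ 0)
    (hB : ∀ B : O F p n m t →ₗ[F] O F p n m t →ₗ[F] F,
      (∀ a b w, B (c a b) w = B a (c b w)) → (∀ a, T a = 0 → B a = 0) → B u = 0) :
    ¬ ∃ β : LinearMap.BilinForm F (LinearMap.range T), IsAssociative hL β ∧ β.Nondegenerate := by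
  rintro ⟨β, hβ, hnd⟩
  have hc (a b) : T.rangeRestrict (c a b) =
      ⟨sbr (T.rangeRestrict a) (T.rangeRestrict b), hL _ (Subtype.mem _) _ (Subtype.mem _)⟩ :=
    Subtype.ext (hT a b).symm
  have h0 := hB (β.compl₁₂ T.rangeRestrict T.rangeRestrict)
    (fun a b w => by
      simp only [LinearMap.compl₁₂_apply]
      rw [hc, hc]
      exact hβ _ _ _)
    (fun a ha => by
      ext1 w
      have : T.rangeRestrict a = 0 := Subtype.ext ha
      simp [LinearMap.compl₁₂_apply, this])
  refine hu (congrArg Subtype.val (hnd.1 (T.rangeRestrict u) ?_))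
  rintro ⟨_, w, rfl⟩
  exact LinearMap.congr_fun h0 w

theorem sbr_TK_xEven_mul_xOdd [CharP F p] (hp : p.Prime) (h : ∀ i, 1 < p ^ t i) (i : Fin n)
    (f : O F p n (n + 1) t) :
    sbr (TK (xEven i * xOdd i.castSucc)) (TK f) =
      TK (xOdd i.castSucc * dOdd i.castSucc f - xEven i * dEven i f) := by
  have h1 : dOdd (Fin.last n) (parity (xEven i * xOdd i.castSucc : O F p n (n + 1) t)) = 0 := by
    rw [(isOdd_xEven_mul_xOdd _ _).parity, map_neg, dOdd_xEven_mul_xOdd,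
      if_neg (last_ne_castSucc i), neg_zero]
  rw [(isContactMap_TK hp h).sbr, LinearMap.toAddMonoidHom_coe, h1, zero_mul, smul_zero, sub_zero,
    TK_xEven_mul_xOdd hp h]

theorem one_lt_pow_of_pos (hp : p.Prime) (ht : ∀ i, 0 < t i) (i : Fin n) : 1 < p ^ t i :=
  Nat.one_lt_pow (ht i).ne' hp.one_lt

/-- The vector x_i lies in the left radical of every pulled-back form: pairing it with any monomial
gives zero in each case of `bas_cases`. -/
theorem not_exists_isAssociative_HO [CharP F p] (hp : p.Prime) (ht : ∀ i, 0 < t i) (hn : 0 < n)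
    (hL : IsClosedSbr (HO F p n t)) :
    ¬ ∃ β : LinearMap.BilinForm F (HO F p n t), IsAssociative hL β ∧ β.Nondegenerate := by
  have h := one_lt_pow_of_pos hp ht
  let i : Fin n := ⟨0, hn⟩
  refine not_exists_isAssociative (TH id) (fun a b => TH id a b)
    (fun a b => by simpa using (isContactMap_TH hp id).sbr a b) hL (xEven i) ?_ ?_
  · intro h0
    have h1 := LinearMap.congr_fun h0 (xOdd i)
    rw [TH_xEven h, id, dOdd_xOdd, if_pos rfl, LinearMap.zero_apply] at h1
    have h2 := mon_zero_mul (bas (fun i => ⟨0, zero_lt_one.trans (h i)⟩, ∅) : O F p n n t)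
    rw [h1, zero_mul] at h2
    exact bas.ne_zero _ h2.symm
  · intro B hB hB0
    refine bas.ext fun a => ?_
    rw [LinearMap.zero_apply]
    rcases bas_cases (F := F) ht i i a with ⟨g, hg⟩ | ⟨g, hg⟩ | ⟨h1, h2⟩
    -- Here c(x_i, x_{i'}) = 1, which `TH` annihilates, so B(x_i, ∂_i g) = -B(1, g) would-be sign
    -- aside equals zero.
    · have h3 := hB (xEven i) (xOdd i) g
      have h4 : TH id (xOdd i) g = -dEven i g := TH_xOdd h Function.injective_id i g
      rw [h4, hg, TH_xEven h, id, dOdd_xOdd, if_pos rfl, hB0 _ (TH_mon_zero h id), map_neg] at h3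
      simpa using h3.symm
    · have h3 := hB (xEven i) (xEven i) g
      rw [TH_xEven h, TH_xEven h, id, hg, dOdd_xEven, map_zero] at h3
      exact h3.symm
    -- Here c(x_i, x_i x_{i'}) = x_i, while x_i x_{i'} acts on this monomial by 2, so B(x_i, a) = 2
    -- B(x_i, a).
    · have h3 := hB (xEven i) (xEven i * xOdd i) (bas a)
      have h4 : TH id (xEven i * xOdd i) (bas a : O F p n n t) = _ :=
        TH_xEven_mul_xOdd hp h Function.injective_id i (bas a)
      rw [h4, id, h1, h2, TH_xEven h, id, dOdd_xEven_mul_xOdd, if_pos rfl, sub_neg_eq_add,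
        map_add] at h3
      simpa using h3

/-- The unit is useful here because T(1) = -2Z, so that c(1, f) = -2 Z(f): it vanishes for 1, x_i,
x_{i'} and x_i x_{i'}. -/
theorem not_exists_isAssociative_KO [CharP F p] (hp : p.Prime) (h2 : (2 : F) ≠ 0)
    (ht : ∀ i, 0 < t i) (hn : 0 < n) (hL : IsClosedSbr (KO F p n t)) :
    ¬ ∃ β : LinearMap.BilinForm F (KO F p n t), IsAssociative hL β ∧ β.Nondegenerate := by
  have h := one_lt_pow_of_pos hp ht
  let i : Fin n := ⟨0, hn⟩
  refine not_exists_isAssociative TK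
    (fun a b => TK a b - (2 : ℤ) • (dOdd (Fin.last n) (parity a) * b))
    (isContactMap_TK hp h).sbr hL (mon 0 ∅) ?_ ?_
  · intro h0
    have h1 := LinearMap.congr_fun h0 (xOdd (Fin.last n))
    rw [TK_mon_zero h, LinearMap.smul_apply, dOdd_xOdd, if_pos rfl, LinearMap.zero_apply,
      smul_eq_zero, or_iff_right (neg_ne_zero.2 h2)] at h1
    have h2 := mon_zero_mul (bas (fun i => ⟨0, zero_lt_one.trans (h i)⟩, ∅) : O F p n (n + 1) t)
    rw [h1, zero_mul] at h2
    exact bas.ne_zero _ h2.symm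
  · intro B hB hB0
    -- From c(1, 1) = 0 and c(1, g) = -2 Z(g).
    have hz (g) : B (mon 0 ∅) (dOdd (Fin.last n) g) = 0 := by
      have h3 := hB (mon 0 ∅) (mon 0 ∅) g
      simpa [TK_mon_zero h, isEven_mon_zero.parity, dOdd_mon_zero, h2] using h3
    -- If Z(f) = 0 then c(1, f) = 0 and c(f, w) = T(f)(w), so B(1, T(f)(w)) = B(c(1, f), w) = 0.
    have hc (f w) (hf : dOdd (Fin.last n) f = 0) (hf' : dOdd (Fin.last n) (parity f) = 0) :
        B (mon 0 ∅) (TK f w) = 0 := by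
      have h3 := hB (mon 0 ∅) f w
      simpa [TK_mon_zero h, isEven_mon_zero.parity, dOdd_mon_zero, hf, hf'] using h3.symm
    have hy : dOdd (Fin.last n) (xOdd i.castSucc : O F p n (n + 1) t) = 0 := by
      rw [dOdd_xOdd, if_neg (last_ne_castSucc i)]
    have hxy : dOdd (Fin.last n) (xEven i * xOdd i.castSucc : O F p n (n + 1) t) = 0 := by
      rw [dOdd_xEven_mul_xOdd, if_neg (last_ne_castSucc i)]
    refine bas.ext fun a => ?_
    rw [LinearMap.zero_apply]
    rcases bas_cases (F := F) ht i i.castSucc a with ⟨g, hg⟩ | ⟨g, hg⟩ | ⟨h3, h4⟩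
    · have h3 := hc (xOdd i.castSucc) g hy (by rw [(isOdd_xOdd _).parity, map_neg, hy, neg_zero])
      -- The unwanted term x_{i'} Z(g) of T(x_{i'})(g) equals -Z(x_{i'} g), which is killed by `hz`.
      have h4 := hz (xOdd i.castSucc * g)
      rw [dOdd_mul, hy, zero_mul, zero_add, (isOdd_xOdd _).parity, neg_mul] at h4
      rw [TK_xOdd h, sub_eq_add_neg, map_add, h4, hg, add_zero, map_neg, neg_eq_zero] at h3
      exact h3
    · have h3 := hc (xEven i) g (dOdd_xEven _ _) (by rw [(isEven_xEven _).parity, dOdd_xEven])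
      have h4 := hz (xEven i * g)
      rw [dOdd_mul, dOdd_xEven, zero_mul, zero_add, (isEven_xEven _).parity] at h4
      rw [TK_xEven h, map_sub, h4, hg, sub_zero] at h3
      exact h3
    · have h5 := hc (xEven i * xOdd i.castSucc) (bas a) hxy
        (by rw [(isOdd_xEven_mul_xOdd _ _).parity, map_neg, hxy, neg_zero])
      rw [TK_xEven_mul_xOdd hp h, h3, h4, sub_neg_eq_add, ← two_smul F, map_smul,
        smul_eq_zero, or_iff_right h2] at h5
      exact h5

end Forms

/-! ### Gradings and the dimensions of the components of HO. -/

section Grading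

variable {F : Type*} [Field F] {p n m : ℕ} {t : Fin n → ℕ} {w : Fin m → ℕ}

variable (F p t) in
/-- The component of degree `k` of `𝒪(n, m; t)`, where the odd variable `x_j` has degree `w j`. -/
noncomputable def homog (w : Fin m → ℕ) (k : ℤ) : Submodule F (O F p n m t) :=
  Submodule.span F {f | ∃ a : Mono p n m t, (deg w a : ℤ) = k ∧ bas a = f}

theorem bas_mem_homog (a : Mono p n m t) : bas a ∈ homog F p t w (deg w a) :=
  Submodule.subset_span ⟨a, rfl, rfl⟩

theorem mon_mem_homog {α : Fin n → ℕ} {u : Finset (Fin m)} {k : ℤ}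
    (h : ((∑ i, α i + ∑ j ∈ u, w j : ℕ) : ℤ) = k) :
    (mon α u : O F p n m t) ∈ homog F p t w k := by
  by_cases hα : ∀ i, α i < p ^ t i
  · rw [mon_of_lt hα]
    exact Submodule.subset_span ⟨(fun i => ⟨α i, hα i⟩, u), h, rfl⟩
  · rw [mon_of_not_lt hα]
    exact Submodule.zero_mem _

theorem mem_homog_of_eq {k l : ℤ} {f : O F p n m t} (hf : f ∈ homog F p t w k) (h : k = l) :
    f ∈ homog F p t w l := h ▸ hf

theorem homog_induction {k : ℤ} {S : Submodule F (O F p n m t)}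
    (h : ∀ a, (deg w a : ℤ) = k → bas a ∈ S) : homog F p t w k ≤ S :=
  Submodule.span_le.2 (by rintro _ ⟨a, ha, rfl⟩; exact h a ha)

theorem mul_mem_homog {k l : ℤ} {f g : O F p n m t} (hf : f ∈ homog F p t w k)
    (hg : g ∈ homog F p t w l) : f * g ∈ homog F p t w (k + l) := by
  have h1 : ∀ b : Mono p n m t, (deg w b : ℤ) = l →
      homog F p t w k ≤ (homog F p t w (k + l)).comap (mul.flip (bas b)) := by
    refine fun b hb => homog_induction fun a ha => ?_
    rw [Submodule.mem_comap, LinearMap.flip_apply, mul_apply, ← mon_expo a, ← mon_expo b,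
      mon_mul_mon]
    split_ifs with h
    · refine Submodule.smul_mem _ _ (mon_mem_homog ?_)
      rw [← ha, ← hb, Finset.sum_union h, deg, deg]
      simp only [Pi.add_apply, Finset.sum_add_distrib]
      push_cast
      ring
    · exact Submodule.zero_mem _
  have h2 : homog F p t w l ≤ (homog F p t w (k + l)).comap (mul f) :=
    homog_induction fun b hb => h1 b hb hf
  exact h2 hg

theorem dEven_mem_homog {k : ℤ} {f : O F p n m t} (hf : f ∈ homog F p t w k) (i : Fin n) :
    dEven i f ∈ homog F p t w (k - 1) := by
  have h1 : homog F p t w k ≤ (homog F p t w (k - 1)).comap (dEven i) := by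
    refine homog_induction fun a ha => ?_
    rw [Submodule.mem_comap, ← mon_expo a, dEven_mon (expo_lt a i)]
    split_ifs with h
    · exact Submodule.zero_mem _
    · refine mon_mem_homog ?_
      have h2 : ∑ j, (expo a - Pi.single i 1 : Fin n → ℕ) j + 1 = ∑ j, expo a j := by
        rw [← Finset.add_sum_erase _ _ (Finset.mem_univ i),
          ← Finset.add_sum_erase Finset.univ (expo a) (Finset.mem_univ i)]
        have h3 : ∀ j ∈ Finset.univ.erase i,
            (expo a - Pi.single i 1 : Fin n → ℕ) j = expo a j := fun j hj => by
          simp [Finset.ne_of_mem_erase hj]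
        rw [Finset.sum_congr rfl h3, Pi.sub_apply, Pi.single_eq_same, add_right_comm,
          Nat.sub_add_cancel (Nat.one_le_iff_ne_zero.2 h)]
      rw [← ha, deg, ← h2]
      push_cast
      ring
  exact h1 hf

theorem dOdd_mem_homog {k : ℤ} {f : O F p n m t} (hf : f ∈ homog F p t w k) (j : Fin m) :
    dOdd j f ∈ homog F p t w (k - w j) := by
  have h1 : homog F p t w k ≤ (homog F p t w (k - w j)).comap (dOdd j) := by
    refine homog_induction fun a ha => ?_
    rw [Submodule.mem_comap, ← mon_expo a, dOdd_mon]
    split_ifs with h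
    · refine Submodule.smul_mem _ _ (mon_mem_homog ?_)
      rw [← ha, deg, ← Finset.add_sum_erase _ _ h]
      push_cast
      ring
    · exact Submodule.zero_mem _
  exact h1 hf

theorem xEven_mem_homog (i : Fin n) : (xEven i : O F p n m t) ∈ homog F p t w 1 :=
  mon_mem_homog (by simp)

theorem xOdd_mem_homog (j : Fin m) : (xOdd j : O F p n m t) ∈ homog F p t w (w j) :=
  mon_mem_homog (by simp)

theorem mul_dEven_mem_wittGr {k : ℤ} {f : O F p n m t} (hf : f ∈ homog F p t w (k + 1))
    (i : Fin n) : mul f * dEven i ∈ wittGr F p t w k := by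
  have h1 : homog F p t w (k + 1) ≤
      (wittGr F p t w k).comap ((LinearMap.mulRight F (dEven i)).comp mul) :=
    homog_induction fun a ha => Submodule.subset_span (Or.inl ⟨a, i, ha, rfl⟩)
  exact h1 hf

theorem mul_dOdd_mem_wittGr {k : ℤ} {j : Fin m} {f : O F p n m t}
    (hf : f ∈ homog F p t w (k + w j)) : mul f * dOdd j ∈ wittGr F p t w k := by
  have h1 : homog F p t w (k + w j) ≤
      (wittGr F p t w k).comap ((LinearMap.mulRight F (dOdd j)).comp mul) :=
    homog_induction fun a ha => Submodule.subset_span (Or.inr ⟨a, j, ha, rfl⟩)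
  exact h1 hf

/-- The loss of 2 is the total degree of a conjugate pair: one variable is differentiated away, the
other belongs to the derivation. -/
theorem TH_bas_mem_wittGr {e : Fin n → Fin m} (he : ∀ i, w (e i) = 1) (a : Mono p n m t) :
    TH e (bas a) ∈ wittGr F p t w (deg w a - 2) := by
  rw [TH, Module.Basis.constr_basis]
  refine Submodule.sum_mem _ fun i _ => Submodule.add_mem _ ?_ (Submodule.smul_mem _ _ ?_)
  · refine mul_dOdd_mem_wittGr ?_
    refine mem_homog_of_eq (dEven_mem_homog (bas_mem_homog a) i) ?_
    rw [he]; push_cast; ring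
  · refine mul_dEven_mem_wittGr ?_ i
    refine mem_homog_of_eq (dOdd_mem_homog (bas_mem_homog a) (e i)) ?_
    rw [he]; push_cast; ring

theorem euler_mem_homog {w : Fin (n + 1) → ℕ} {k : ℤ}
    {f : O F p n (n + 1) t} (hf : f ∈ homog F p t w k) : euler f ∈ homog F p t w k := by
  rw [euler_apply]
  refine Submodule.sum_mem _ fun i _ => Submodule.add_mem _ ?_ ?_
  · refine mem_homog_of_eq (mul_mem_homog (xEven_mem_homog i) (dEven_mem_homog hf i)) ?_
    ring
  · refine mem_homog_of_eq
      (mul_mem_homog (xOdd_mem_homog i.castSucc) (dOdd_mem_homog hf i.castSucc)) ?_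
    ring

theorem TK_bas_mem_wittGr {w : Fin (n + 1) → ℕ} (hw : ∀ i : Fin n, w i.castSucc = 1)
    (hw' : w (Fin.last n) = 2) (a : Mono p n (n + 1) t) :
    TK (bas a) ∈ wittGr F p t w (deg w a - 2) := by
  rw [TK, Module.Basis.constr_basis]
  refine Submodule.add_mem _ (Submodule.add_mem _ (TH_bas_mem_wittGr hw a)
    (Submodule.smul_mem _ _ ?_)) ?_
  · rw [euler, Finset.mul_sum]
    have hd := dOdd_mem_homog (bas_mem_homog (F := F) (w := w) a) (Fin.last n)
    refine Submodule.sum_mem _ fun i _ => ?_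
    rw [mul_add, ← mul_assoc, ← mul_assoc, mul_mul, mul_mul]
    refine Submodule.add_mem _ (mul_dEven_mem_wittGr ?_ i) (mul_dOdd_mem_wittGr ?_)
    · refine mem_homog_of_eq (mul_mem_homog hd (xEven_mem_homog i)) ?_
      rw [hw']; push_cast; ring
    · refine mem_homog_of_eq (mul_mem_homog hd (xOdd_mem_homog i.castSucc)) ?_
      rw [hw']; push_cast; ring
  · refine mul_dOdd_mem_wittGr ?_
    rw [hw', Nat.cast_ofNat, sub_add_cancel]
    exact Submodule.sub_mem _ (euler_mem_homog (bas_mem_homog a))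
      (Submodule.smul_mem _ _ (bas_mem_homog a))

/-- The projection onto the component of degree `k`. -/
noncomputable def degProj (w : Fin m → ℕ) (k : ℤ) : Module.End F (O F p n m t) :=
  bas.constr F fun a => if (deg w a : ℤ) = k then bas a else 0

theorem degProj_of_mem {k : ℤ} {f : O F p n m t} (hf : f ∈ homog F p t w k) (l : ℤ) :
    degProj w l f = if k = l then f else 0 := by
  have h1 : homog F p t w k ≤
      LinearMap.ker (degProj w l - if k = l then 1 else 0 : Module.End F (O F p n m t)) := by
    refine homog_induction fun a ha => ?_
    rw [LinearMap.mem_ker, LinearMap.sub_apply, degProj, Module.Basis.constr_basis, ha]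
    split_ifs <;> simp
  have h2 := h1 hf
  rw [LinearMap.mem_ker, LinearMap.sub_apply, sub_eq_zero] at h2
  rw [h2]
  split_ifs <;> simp

theorem apply_xEven_mem_homog (h : ∀ i, 1 < p ^ t i) {k : ℤ} {A : Module.End F (O F p n m t)}
    (hA : A ∈ wittGr F p t w k) (i : Fin n) : A (xEven i) ∈ homog F p t w (k + 1) := by
  have h1 : wittGr F p t w k ≤ (homog F p t w (k + 1)).comap
      (LinearMap.applyₗ (xEven i : O F p n m t)) := by
    refine Submodule.span_le.2 ?_
    rintro _ (⟨a, l, ha, rfl⟩ | ⟨a, l, ha, rfl⟩)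
    · simp only [SetLike.mem_coe, Submodule.mem_comap, LinearMap.applyₗ_apply_apply,
        Module.End.mul_apply, dEven_xEven h, mul_apply]
      split_ifs
      · rw [mul_mon_zero, ← ha]; exact bas_mem_homog a
      · rw [mul_zero]; exact Submodule.zero_mem _
    · simp [dOdd_xEven]
  exact h1 hA

theorem apply_xOdd_mem_homog (h : ∀ i, 1 < p ^ t i) {k : ℤ} {A : Module.End F (O F p n m t)}
    (hA : A ∈ wittGr F p t w k) (j : Fin m) : A (xOdd j) ∈ homog F p t w (k + w j) := by
  have h1 : wittGr F p t w k ≤ (homog F p t w (k + w j)).comap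
      (LinearMap.applyₗ (xOdd j : O F p n m t)) := by
    refine Submodule.span_le.2 ?_
    rintro _ (⟨a, l, ha, rfl⟩ | ⟨a, l, ha, rfl⟩)
    · simp [dEven_xOdd h]
    · simp only [SetLike.mem_coe, Submodule.mem_comap, LinearMap.applyₗ_apply_apply,
        Module.End.mul_apply, dOdd_xOdd, mul_apply]
      split_ifs with hl
      · rw [mul_mon_zero, ← hl, ← ha]; exact bas_mem_homog a
      · rw [mul_zero]; exact Submodule.zero_mem _
  exact h1 hA

/-- An element of W is determined by its values on the variables, so operators can be compared
through the grading of 𝒪. -/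
theorem eq_sum_of_mem_wittGr (h : ∀ i, 1 < p ^ t i) {k : ℤ} {A : Module.End F (O F p n m t)}
    (hA : A ∈ wittGr F p t w k) :
    A = ∑ i, mul (A (xEven i)) * dEven i + ∑ j, mul (A (xOdd j)) * dOdd j := by
  rw [wittGr] at hA
  induction hA using Submodule.span_induction with
  | mem A hA =>
    rcases hA with ⟨a, l, ha, rfl⟩ | ⟨a, l, ha, rfl⟩
    · simp [dEven_xEven h, dEven_xOdd h, mul_apply, apply_ite mul, mul_mon_zero, ite_mul,
        apply_ite (bas a * · : O F p n m t → _)]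
    · simp [dOdd_xEven, dOdd_xOdd, mul_apply, apply_ite mul, mul_mon_zero, ite_mul,
        apply_ite (bas a * · : O F p n m t → _)]
  | zero => simp
  | add A B _ _ hA hB =>
    nth_rw 1 [hA, hB]
    simp only [LinearMap.add_apply, map_add, add_mul, Finset.sum_add_distrib]
    abel
  | smul c A _ hA =>
    nth_rw 1 [hA]
    simp only [LinearMap.smul_apply, map_smul, smul_mul_assoc, Finset.smul_sum, smul_add]

/-- Homogeneity of T(f) does not force f to be homogeneous, since T may have a kernel; the other
components of f may be dropped nevertheless. -/
theorem eq_apply_degProj (h : ∀ i, 1 < p ^ t i) {T : O F p n m t →ₗ[F] Module.End F (O F p n m t)}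
    (hT : ∀ a, T (bas a) ∈ wittGr F p t w (deg w a - 2)) {k : ℤ} {f : O F p n m t}
    (hf : T f ∈ wittGr F p t w k) : T f = T (degProj w (k + 2) f) := by
  have hg : T (degProj w (k + 2) f) ∈ wittGr F p t w k := by
    have : (⊤ : Submodule F (O F p n m t)) ≤
        (wittGr F p t w k).comap (T.comp (degProj w (k + 2))) := by
      rw [← bas.span_eq, Submodule.span_le]
      rintro _ ⟨a, rfl⟩
      simp only [SetLike.mem_coe, Submodule.mem_comap, LinearMap.comp_apply, degProj,
        Module.Basis.constr_basis]
      split_ifs with ha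
      · have := hT a
        rwa [ha, add_sub_cancel_right] at this
      · simp
    exact this trivial
  -- On monomials `T` has degree -2, so projecting the value at a variable is the same as projecting
  -- the argument first.
  have hE (i) (f : O F p n m t) :
      degProj w (k + 1) (T f (xEven i)) = T (degProj w (k + 2) f) (xEven i) := by
    induction f using O.induction with
    | h0 => simp
    | hadd f f' hf hf' => simp only [map_add, LinearMap.add_apply, hf, hf']
    | hsmul c f hf => simp only [map_smul, LinearMap.smul_apply, hf]
    | hbas a =>
      rw [degProj_of_mem (apply_xEven_mem_homog h (hT a) i), degProj_of_mem (bas_mem_homog a)]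
      by_cases ha : (deg w a : ℤ) = k + 2
      · rw [if_pos ha, if_pos (by omega)]
      · rw [if_neg ha, if_neg (by omega)]; simp
  have hO (j) (f : O F p n m t) :
      degProj w (k + w j) (T f (xOdd j)) = T (degProj w (k + 2) f) (xOdd j) := by
    induction f using O.induction with
    | h0 => simp
    | hadd f f' hf hf' => simp only [map_add, LinearMap.add_apply, hf, hf']
    | hsmul c f hf => simp only [map_smul, LinearMap.smul_apply, hf]
    | hbas a =>
      rw [degProj_of_mem (apply_xOdd_mem_homog h (hT a) j), degProj_of_mem (bas_mem_homog a)]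
      by_cases ha : (deg w a : ℤ) = k + 2
      · rw [if_pos ha, if_pos (by omega)]
      · rw [if_neg ha, if_neg (by omega)]; simp
  rw [eq_sum_of_mem_wittGr h hf, eq_sum_of_mem_wittGr h hg]
  congr 1
  · refine Finset.sum_congr rfl fun i _ => ?_
    rw [← hE i f, degProj_of_mem (apply_xEven_mem_homog h hf i), if_pos rfl]
  · refine Finset.sum_congr rfl fun j _ => ?_
    rw [← hO j f, degProj_of_mem (apply_xOdd_mem_homog h hf j), if_pos rfl]

/-- The index of the monomial of the largest degree. -/
def topMono (h : ∀ i, 1 < p ^ t i) : Mono p n m t :=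
  (fun i => ⟨p ^ t i - 1, Nat.sub_lt (zero_lt_one.trans (h i)) zero_lt_one⟩, Finset.univ)

theorem deg_topMono (h : ∀ i, 1 < p ^ t i) :
    deg w (topMono h : Mono p n m t) = ∑ i, (p ^ t i - 1) + ∑ j, w j := rfl

/-- Exponents and odd variables each contribute at most their maximum, so equality forces both to be
maximal; positive weights exclude a missing odd variable. -/
theorem eq_topMono (h : ∀ i, 1 < p ^ t i) (hw : ∀ j, 0 < w j) {a : Mono p n m t}
    (ha : deg w a = ∑ i, (p ^ t i - 1) + ∑ j, w j) : a = topMono h := by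
  have h1 (i) (_ : i ∈ Finset.univ) : expo a i ≤ p ^ t i - 1 := Nat.le_sub_one_of_lt (expo_lt a i)
  have h2 : ∑ j ∈ a.2, w j ≤ ∑ j, w j := Finset.sum_le_univ_sum_of_nonneg fun _ => Nat.zero_le _
  have h3 := Finset.sum_le_sum h1
  rw [deg] at ha
  have h4 := (Finset.sum_eq_sum_iff_of_le h1).1 (by omega)
  refine Prod.ext (funext fun i => Fin.ext (h4 i (Finset.mem_univ i))) ?_
  by_contra hne
  obtain ⟨j, hj⟩ : ∃ j, j ∉ a.2 := by simpa [topMono, Finset.eq_univ_iff_forall] using hne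
  have h5 : ∑ j ∈ insert j a.2, w j ≤ ∑ j, w j :=
    Finset.sum_le_univ_sum_of_nonneg fun _ => Nat.zero_le _
  rw [Finset.sum_insert hj] at h5
  have := hw j
  omega

theorem degProj_top (h : ∀ i, 1 < p ^ t i) (hw : ∀ j, 0 < w j) (f : O F p n m t) :
    degProj w ((∑ i, (p ^ t i - 1) + ∑ j, w j : ℕ) : ℤ) f ∈
      Submodule.span F {(bas (topMono h) : O F p n m t)} := by
  induction f using O.induction with
  | h0 => simp
  | hadd f f' hf hf' => rw [map_add]; exact Submodule.add_mem _ hf hf'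
  | hsmul c f hf => rw [map_smul]; exact Submodule.smul_mem _ _ hf
  | hbas a =>
    rw [degProj, Module.Basis.constr_basis]
    split_ifs with ha
    · rw [eq_topMono h hw (Nat.cast_injective (R := ℤ) ha)]
      exact Submodule.mem_span_singleton_self _
    · exact Submodule.zero_mem _

theorem mon_zero_ne_zero (h : ∀ i, 1 < p ^ t i) (u : Finset (Fin m)) :
    (mon 0 u : O F p n m t) ≠ 0 := by
  rw [mon_of_lt (α := 0) fun i => zero_lt_one.trans (h i)]
  exact bas.ne_zero _

theorem bas_of_deg_eq_zero (hw : ∀ j, 0 < w j) {a : Mono p n m t} (ha : deg w a = 0) :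
    (bas a : O F p n m t) = mon 0 ∅ := by
  rw [deg, Nat.add_eq_zero_iff, Finset.sum_eq_zero_iff, Finset.sum_eq_zero_iff] at ha
  have h1 : expo a = 0 := funext fun i => ha.1 i (Finset.mem_univ i)
  have h2 : a.2 = ∅ := Finset.eq_empty_of_forall_notMem fun j hj => (hw j).ne' (ha.2 j hj)
  rw [← mon_expo, h1, h2]

theorem dEven_mem_wittGr (i : Fin n) : (dEven i : Module.End F (O F p n m t)) ∈
    wittGr F p t w (-1) := by
  rw [← one_mul (dEven i), ← mul_mon_zero_eq_one]
  exact mul_dEven_mem_wittGr (mon_mem_homog (by simp)) i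

theorem dOdd_mem_wittGr (j : Fin m) : (dOdd j : Module.End F (O F p n m t)) ∈
    wittGr F p t w (-w j) := by
  rw [← one_mul (dOdd j), ← mul_mon_zero_eq_one]
  exact mul_dOdd_mem_wittGr (mon_mem_homog (by simp))

theorem linearIndependent_derivations (h : ∀ i, 1 < p ^ t i) :
    LinearIndependent F
      (Sum.elim dEven dOdd : Fin n ⊕ Fin m → Module.End F (O F p n m t)) := by
  rw [Fintype.linearIndependent_iff]
  intro c hc
  have h1 := mon_zero_ne_zero (F := F) h (∅ : Finset (Fin m))
  rintro (i | j)
  · have := LinearMap.congr_fun hc (xEven i)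
    simpa [LinearMap.sum_apply, dEven_xEven h, dOdd_xEven, h1] using this
  · have := LinearMap.congr_fun hc (xOdd j)
    simpa [LinearMap.sum_apply, dEven_xOdd h, dOdd_xOdd, h1] using this

theorem dOdd_ne_zero (h : ∀ i, 1 < p ^ t i) (j : Fin m) :
    (dOdd j : Module.End F (O F p n m t)) ≠ 0 :=
  (linearIndependent_derivations h).ne_zero (Sum.inr j)

theorem finrank_HOgr_neg_one (hp : p.Prime) (ht : ∀ i, 0 < t i) :
    Module.finrank F (HOgr F p n t (-1)) = 2 * n := by
  have h := one_lt_pow_of_pos hp ht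
  have key : HOgr F p n t (-1) = Submodule.span F
      (Set.range (Sum.elim dEven dOdd : Fin n ⊕ Fin n → Module.End F (O F p n n t))) := by
    refine le_antisymm (inf_le_right.trans (Submodule.span_le.2 ?_)) (Submodule.span_le.2 ?_)
    · rintro _ (⟨a, i, ha, rfl⟩ | ⟨a, j, ha, rfl⟩)
      · rw [bas_of_deg_eq_zero (w := fun _ => 1) (fun _ => one_pos) (by omega),
          mul_mon_zero_eq_one, one_mul]
        exact Submodule.subset_span ⟨Sum.inl i, rfl⟩
      · rw [bas_of_deg_eq_zero (w := fun _ => 1) (fun _ => one_pos) (by push_cast at ha; omega),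
          mul_mon_zero_eq_one, one_mul]
        exact Submodule.subset_span ⟨Sum.inr j, rfl⟩
    · rintro _ ⟨i | j, rfl⟩
      · refine ⟨⟨-xOdd i, LinearMap.ext fun w => ?_⟩, dEven_mem_wittGr i⟩
        have := TH_xOdd (F := F) h Function.injective_id i w
        rw [map_neg, LinearMap.neg_apply, ← id_eq i, this, neg_neg]
        rfl
      · exact ⟨⟨xEven j, LinearMap.ext (TH_xEven h id j)⟩, dOdd_mem_wittGr j⟩
  rw [key, finrank_span_eq_card (linearIndependent_derivations h), Fintype.card_sum,
    Fintype.card_fin, two_mul]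

theorem finrank_HOgr_top (hp : p.Prime) (ht : ∀ i, 0 < t i) (hn : 0 < n) :
    Module.finrank F (HOgr F p n t ((xi p n t : ℤ) - 2)) = 1 := by
  have h := one_lt_pow_of_pos hp ht
  have hxi : xi p n t = ∑ i, (p ^ t i - 1) + ∑ _ : Fin n, 1 := by simp [xi]
  have key : HOgr F p n t ((xi p n t : ℤ) - 2) =
      Submodule.span F {TH id (bas (topMono h) : O F p n n t)} := by
    refine le_antisymm ?_ ((Submodule.span_singleton_le_iff_mem _ _).2 ⟨⟨_, rfl⟩, ?_⟩)
    · rintro _ ⟨⟨f, rfl⟩, hf⟩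
      rw [eq_apply_degProj h (TH_bas_mem_wittGr fun _ => rfl) hf, sub_add_cancel, hxi]
      obtain ⟨c, hc⟩ := Submodule.mem_span_singleton.1
        (degProj_top (F := F) (w := fun _ => 1) h (fun _ => one_pos) f)
      rw [← hc, map_smul]
      exact Submodule.smul_mem _ _ (Submodule.mem_span_singleton_self _)
    · rw [hxi, ← deg_topMono (w := fun _ => 1) h]
      exact TH_bas_mem_wittGr (fun _ => rfl) _
  rw [key, finrank_span_singleton]
  intro h0
  let i : Fin n := ⟨0, hn⟩
  -- The value at x_{i'} is ∂_i of the top monomial, a basis vector because π_i > 0.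
  have h1 := LinearMap.congr_fun h0 (xOdd i)
  have h2 : expo (topMono h : Mono p n n t) i ≠ 0 := by
    have : expo (topMono h : Mono p n n t) i = p ^ t i - 1 := rfl
    have := h i
    omega
  simp only [TH_apply, id, dOdd_xOdd, dEven_xOdd h, mul_zero, add_zero, LinearMap.zero_apply,
    mul_ite, mul_mon_zero, Finset.sum_ite_eq', Finset.mem_univ, if_true] at h1
  rw [← mon_expo, dEven_mon (expo_lt _ i), if_neg h2,
    mon_of_lt (α := expo (topMono h) - _) fun j => (Nat.sub_le _ _).trans_lt (expo_lt _ j)] at h1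
  exact bas.ne_zero _ h1

/-! ### Zero weight spaces in the extreme components of KO. -/

variable (n) in
/-- The degrees of the odd variables in the principal grading of `KO`. -/
def contactWeight : Fin (n + 1) → ℕ := fun j => if j = Fin.last n then 2 else 1

theorem contactWeight_castSucc (i : Fin n) : contactWeight n i.castSucc = 1 :=
  if_neg (last_ne_castSucc i).symm

theorem contactWeight_last : contactWeight n (Fin.last n) = 2 := if_pos rfl

theorem contactWeight_pos (j : Fin (n + 1)) : 0 < contactWeight n j := by
  rw [contactWeight]
  split_ifs <;> omega

theorem TK_mem_torusKO (i : Fin n) :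
    TK (xEven i * xOdd i.castSucc) ∈ torusKO F p n t := by
  rw [← mul_apply]
  exact Submodule.subset_span (Set.mem_range_self i)

theorem finrank_KOgr_top [CharP F p] (hp : p.Prime) (h2 : (2 : F) ≠ 0) (ht : ∀ i, 0 < t i)
    (hn : 0 < n) :
    Module.finrank F ↥(KOgr F p n t (xi p n t : ℤ) ⊓
      weightSpace (KO F p n t) (torusKO F p n t) 0) = 0 := by
  have h := one_lt_pow_of_pos hp ht
  -- The last odd variable has weight 2, so the top degree of 𝒪(n, n + 1; t) is ξ + 2, and `TK`
  -- sends it to degree ξ.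
  have hxi : (xi p n t : ℤ) + 2 = (∑ i, (p ^ t i - 1) + ∑ j, contactWeight n j : ℕ) := by
    simp [xi, Fin.sum_univ_castSucc, contactWeight_castSucc, contactWeight_last, add_assoc]
  have key : KOgr F p n t (xi p n t : ℤ) ⊓
      weightSpace (KO F p n t) (torusKO F p n t) 0 = ⊥ := by
    rw [eq_bot_iff]
    rintro A ⟨⟨⟨f, hf⟩, hA⟩, -, hwt⟩
    let i : Fin n := ⟨0, hn⟩
    have h1 := hwt ⟨_, TK_mem_torusKO i⟩
    rw [Pi.zero_apply, zero_smul] at h1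
    subst hf
    have h2' := eq_apply_degProj h (TK_bas_mem_wittGr contactWeight_castSucc contactWeight_last) hA
    rw [hxi] at h2'
    obtain ⟨c, hc⟩ := Submodule.mem_span_singleton.1
      (degProj_top (F := F) h contactWeight_pos f)
    rw [← hc] at h2'
    have h3 : xEven i * dEven i (bas (topMono h) : O F p n (n + 1) t) = -bas (topMono h) := by
      have h6 : expo (topMono h : Mono p n (n + 1) t) i + 1 = p ^ t i :=
        Nat.sub_add_cancel (h i).le
      rw [← mon_expo, xEven_mul_dEven_mon (expo_lt _ i), natCast_eq_neg_one (ht i) h6,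
        neg_one_smul]
    have h4 : xOdd i.castSucc * dOdd i.castSucc (bas (topMono h) : O F p n (n + 1) t) =
        bas (topMono h) := by
      rw [← mon_expo, xOdd_mul_dOdd_mon]
      exact if_pos (Finset.mem_univ _)
    -- The bracket with T(x_i x_{i'}) is twice the element, so zero weight forces the element to
    -- vanish.
    rw [h2', sbr_TK_xEven_mul_xOdd hp h, map_smul, map_smul, mul_smul_comm, mul_smul_comm, h3, h4,
      smul_neg, sub_neg_eq_add, ← two_smul F, map_smul, smul_eq_zero, or_iff_right h2] at h1
    rw [h2']
    exact h1
  rw [key, finrank_bot]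

theorem sbr_smul_left (c : F) (A B : Module.End F (O F p n m t)) :
    sbr (c • A) B = c • sbr A B := by
  have h : oddPart (c • A) = c • oddPart A := by
    simp only [oddPart, mul_smul_comm, smul_mul_assoc, smul_add]
  rw [sbr, h, sbr, mul_smul_comm, mul_smul_comm, smul_mul_assoc, smul_add, smul_sub,
    smul_comm c (2 : F)]

theorem finrank_KOgr_bottom [CharP F p] (hp : p.Prime) (h2 : (2 : F) ≠ 0) (ht : ∀ i, 0 < t i) :
    Module.finrank F ↥(KOgr F p n t (-2) ⊓
      weightSpace (KO F p n t) (torusKO F p n t) 0) = 1 := by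
  have h := one_lt_pow_of_pos hp ht
  have hK : TK (-(2 : F)⁻¹ • mon 0 ∅) =
      (dOdd (Fin.last n) : Module.End F (O F p n (n + 1) t)) := by
    rw [map_smul, TK_mon_zero h, smul_smul, neg_mul_neg, inv_mul_cancel₀ h2, one_smul]
  have hle : wittGr F p t (contactWeight n) (-2) ≤
      Submodule.span F {(dOdd (Fin.last n) : Module.End F (O F p n (n + 1) t))} := by
    refine Submodule.span_le.2 ?_
    rintro _ (⟨a, i, ha, rfl⟩ | ⟨a, j, ha, rfl⟩)
    -- A coefficient of an even ∂_i would have degree -1.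
    · omega
    · rcases Fin.eq_castSucc_or_eq_last j with ⟨i, rfl⟩ | rfl
      · rw [contactWeight_castSucc] at ha
        omega
      · rw [contactWeight_last] at ha
        rw [bas_of_deg_eq_zero contactWeight_pos (by omega), mul_mon_zero_eq_one, one_mul]
        exact Submodule.mem_span_singleton_self _
  have hmem : (dOdd (Fin.last n) : Module.End F (O F p n (n + 1) t)) ∈
      wittGr F p t (contactWeight n) (-2) := by
    have := dOdd_mem_wittGr (F := F) (p := p) (t := t) (w := contactWeight n) (Fin.last n)
    rwa [contactWeight_last] at this
  have hwt : ∀ A ∈ torusKO F p n t, sbr A (dOdd (Fin.last n)) = 0 := by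
    intro A hA
    rw [torusKO] at hA
    induction hA using Submodule.span_induction with
    | mem A hA =>
      obtain ⟨i, rfl⟩ := hA
      dsimp only
      rw [mul_apply, ← hK, sbr_TK_xEven_mul_xOdd hp h, map_smul, map_smul, dOdd_mon_zero,
        dEven_mon_zero h, smul_zero, mul_zero, mul_zero, sub_zero, map_zero]
    | zero => simp [sbr, oddPart]
    | add A B _ _ hA hB => rw [sbr_add_left, hA, hB, add_zero]
    | smul c A _ hA => rw [sbr_smul_left, hA, smul_zero]
  have key : KOgr F p n t (-2) ⊓ weightSpace (KO F p n t) (torusKO F p n t) 0 =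
      Submodule.span F {(dOdd (Fin.last n) : Module.End F (O F p n (n + 1) t))} := by
    refine le_antisymm (inf_le_left.trans (inf_le_right.trans hle))
      ((Submodule.span_singleton_le_iff_mem _ _).2 ⟨⟨⟨_, hK⟩, hmem⟩, ⟨_, hK⟩, fun A => ?_⟩)
    rw [hwt A A.2, Pi.zero_apply, zero_smul]
  rw [key, finrank_span_singleton (dOdd_ne_zero h _)]

end Grading

end OddCartan

theorem theorem2p2 (F : Type*) [Field F] [IsAlgClosed F] (p : ℕ) [CharP F p] (hp : 3 < p)
    (n : ℕ) (hn : 0 < n) (t : Fin n → ℕ) (ht : ∀ i, 0 < t i) :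
    (∃ hL : OddCartan.IsClosedSbr (OddCartan.HO F p n t),
      ¬ ∃ β : LinearMap.BilinForm F (OddCartan.HO F p n t),
        OddCartan.IsAssociative hL β ∧ β.Nondegenerate) ∧
    (∃ hL : OddCartan.IsClosedSbr (OddCartan.KO F p n t),
      ¬ ∃ β : LinearMap.BilinForm F (OddCartan.KO F p n t),
        OddCartan.IsAssociative hL β ∧ β.Nondegenerate) ∧
    Module.finrank F (OddCartan.HOgr F p n t ((OddCartan.xi p n t : ℤ) - 2)) = 1 ∧
    Module.finrank F (OddCartan.HOgr F p n t (-1)) = 2 * n ∧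
    Module.finrank F ↥(OddCartan.KOgr F p n t (OddCartan.xi p n t : ℤ) ⊓
      OddCartan.weightSpace (OddCartan.KO F p n t) (OddCartan.torusKO F p n t) 0) = 0 ∧
    Module.finrank F ↥(OddCartan.KOgr F p n t (-2) ⊓
      OddCartan.weightSpace (OddCartan.KO F p n t) (OddCartan.torusKO F p n t) 0) = 1 := by
  have hp' : p.Prime := (CharP.char_is_prime_or_zero F p).resolve_right (by omega)
  have h2 : (2 : F) ≠ 0 := by
    have h2' : ((2 : ℕ) : F) ≠ 0 := fun h0 => by
      have := Nat.le_of_dvd two_pos ((CharP.cast_eq_zero_iff F p 2).1 h0)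
      omega
    simpa using h2'
  have hHO : OddCartan.IsClosedSbr (OddCartan.HO F p n t) :=
    (OddCartan.isContactMap_TH hp' id).isClosedSbr
  have hKO : OddCartan.IsClosedSbr (OddCartan.KO F p n t) :=
    (OddCartan.isContactMap_TK hp' (OddCartan.one_lt_pow_of_pos hp' ht)).isClosedSbr
  exact ⟨⟨hHO, OddCartan.not_exists_isAssociative_HO hp' ht hn hHO⟩,
    ⟨hKO, OddCartan.not_exists_isAssociative_KO hp' h2 ht hn hKO⟩,
    OddCartan.finrank_HOgr_top hp' ht hn, OddCartan.finrank_HOgr_neg_one hp' ht,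
    OddCartan.finrank_KOgr_top hp' h2 ht hn, OddCartan.finrank_KOgr_bottom hp' h2 ht⟩
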